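/- Let $d\ge 1$ and let $\Omega\subset\mathbb R^d$ be compact, equal to the closure of its interior, where the interior is a (connected, non-empty) bounded Lipschitz domain; Lebesgue and Sobolev spaces are taken on the interior. Let $w:\Omega\to[0,\infty)$ be continuous, $1<\alpha$ with $\alpha(d-1)<d$, $\tfrac1\alpha+\tfrac1{\alpha'}=1$, $\varepsilon,\delta>0$, and let $\mu^+,\mu^-$ be Borel probability measures on $\Omega$, $\mu=\mu^+-\mu^-$. For $p\in\{\alpha,\alpha'\}$ write $W^{1,p}_\emptyset=\{v\in W^{1,p}(\Omega):\int_\Omega v=0\}$. Assume that for every $\nu\in (W^{1,\alpha}(\Omega))^*$ with $\nu(1)=0$ there is a unique $y\in W^{1,\alpha'}_\emptyset$ with $-\int_\Omega\nabla y\cdot\nabla\varphi=\nu(\varphi)$ for all $\varphi\in W^{1,\alpha}_\emptyset$. For $x\in\Omega$, $p\in\mathbb R^d$ let $$\mathcal G(x,p)=\frac{\varepsilon}{\alpha'}\Big(\frac{(|p|-w(x))_+}{\varepsilon}\Big)^{\alpha'}+\delta\max\{|p|,w(x)\}+\frac\delta2\min\Big\{\frac{|p|^2}{w(x)},w(x)\Big\}$$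 (the last minimum being $0$ where $w(x)=0$), and let $\mathcal G^*(x,q)=\sup_{p\in\mathbb R^d}\big(q\cdot p-\mathcal G(x,p)\big)$ be its Fenchel conjugate in the second variable. For $q\in L^\alpha(\Omega;\mathbb R^d)$ say that $\operatorname{div}q=\mu$ if $-\int_\Omega q\cdot\nabla\varphi\,dx=\int_\Omega\varphi\,d\mu$ for all $\varphi\in W^{1,\alpha'}_\emptyset$, where $\varphi$ is integrated against $\mu$ through its continuous representative on $\Omega$. Consider $$(\mathrm{BP}_\dagger)\quad \min_{y\in W^{1,\alpha'}_\emptyset}\mathcal J(y)=\int_\Omega\mathcal G(x,-\nabla y)\,dx-\int_\Omega y\,d\mu,$$ $$(\mathrm{BP}_{\varepsilon,\delta})\quad -\inf\Big\{\int_\Omega\mathcal G^*(x,q(x))\,dx\ :\ q\in L^\alpha(\Omega;\mathbb R^d),\ \operatorname{div}q=\mu\Big\}.$$ Then: 1. Everything is well defined: every element of $W^{1,\alpha'}(\Omega)$ has exactly one continuous representative on $\Omega$; $\mathcal G^*(x,q)=\frac{w(x)}{2\delta}|q|^2-\delta w(x)$ if $|q|\le\delta$, and $\mathcal G^*(x,q)=\frac\varepsilon\alpha(|q|-\delta)^\alpha-\frac32\delta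 w(x)+|q|w(x)$ otherwise; $\mathcal G(\cdot,\xi)$ is integrable for every $\xi\in L^{\alpha'}(\Omega;\mathbb R^d)$ and $\mathcal G^*(\cdot,q)$ is integrable for every $q\in L^\alpha(\Omega;\mathbb R^d)$. 2. $(\mathrm{BP}_\dagger)$ is the predual problem to $(\mathrm{BP}_{\varepsilon,\delta})$. That is, put $f(y)=-\int_\Omega y\,d\mu$ on $W^{1,\alpha'}_\emptyset$, $g(\xi)=\int_\Omega\mathcal G(x,\xi(x))\,dx$ on $L^{\alpha'}(\Omega;\mathbb R^d)$, and $A=-\nabla:W^{1,\alpha'}_\emptyset\to L^{\alpha'}(\Omega;\mathbb R^d)$. Then $\mathcal J(y)=f(y)+g(Ay)$ for all $y$; the relation $\nu(\xi)=-\int_\Omega q\cdot\xi\,dx$ (for all $\xi$) is a one-to-one correspondence between all $\nu\in (L^{\alpha'}(\Omega;\mathbb R^d))^*$ and all $q\in L^\alpha(\Omega;\mathbb R^d)$; and for corresponding $\nu$ and $q$ the Fenchel dual objective $-f^*(A^*\nu)-g^*(-\nu)$ equals $-\int_\Omega\mathcal G^*(x,q(x))\,dx$ if $\operatorname{div}q=\mu$,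 and $-\infty$ otherwise. 3. Strong duality holds: $\inf_y\mathcal J(y)=-\inf\{\int_\Omega\mathcal G^*(x,q)\,dx: q\in L^\alpha(\Omega;\mathbb R^d),\ \operatorname{div}q=\mu\}$, the minimum of $\mathcal J$ is attained, and the infimum over $q$ is attained at a feasible $q$. -/

import Mathlib

open MeasureTheory Set
open scoped ENNReal NNReal ContDiff

noncomputable section

namespace Beckmann

/-- The ambient space `ℝ^d` with its Euclidean norm. -/
abbrev Space (d : ℕ) : Type := EuclideanSpace ℝ (Fin d)

/-! ### Bounded Lipschitz domains -/

/-- The point `y` of `ℝ^d` without its `j`-th coordinate. -/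
def dropCoord {d : ℕ} (j : Fin d) (y : Space d) : EuclideanSpace ℝ {i : Fin d // i ≠ j} :=
  WithLp.toLp 2 (fun i => y i.1)

/-- The boundary of `U` is Lipschitz: near each boundary point there are new orthogonal coordinates
(the affine isometry `e`), a box `{|y i| < a i}` in these coordinates, and a Lipschitz function `φ`
of all coordinates but the `j`-th one, with values in `[-a j / 2, a j / 2]`, such that inside the
box `U` is the set strictly below the graph of `φ` and the boundary of `U` is that graph. -/
def HasLipschitzBoundary {d : ℕ} (U : Set (Space d)) : Prop :=
  ∀ x ∈ frontier U, ∃ (e : Space d ≃ᵃⁱ[ℝ] Space d) (j : Fin d) (a : Fin d → ℝ)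
    (φ : EuclideanSpace ℝ {i : Fin d // i ≠ j} → ℝ) (K : ℝ≥0),
    (∀ i, |e x i| < a i) ∧
    LipschitzOnWith K φ {y | ∀ i : {i : Fin d // i ≠ j}, |y i| < a i.1} ∧
    (∀ y : EuclideanSpace ℝ {i : Fin d // i ≠ j}, (∀ i, |y i| < a i.1) → |φ y| ≤ a j / 2) ∧
    ∀ z : Space d, (∀ i, |e z i| < a i) →
      ((z ∈ U ↔ e z j < φ (dropCoord j (e z))) ∧
        (z ∈ frontier U ↔ e z j = φ (dropCoord j (e z))))

/-- Bounded Lipschitz domains: bounded, open, connected, non-empty, with Lipschitz boundary. -/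
def IsBoundedLipschitzDomain {d : ℕ} (U : Set (Space d)) : Prop :=
  IsOpen U ∧ IsConnected U ∧ Bornology.IsBounded U ∧ HasLipschitzBoundary U

/-! ### Lebesgue and Sobolev spaces on the interior of a compact set -/

variable {d : ℕ}

/-- Lebesgue measure on the interior of `Ω`. -/
def leb (Ω : TopologicalSpace.Compacts (Space d)) : Measure (Space d) :=
  volume.restrict (interior (Ω : Set (Space d)))

instance (Ω : TopologicalSpace.Compacts (Space d)) : IsFiniteMeasure (leb Ω) :=
  ⟨by
    rw [leb, Measure.restrict_apply_univ]
    exact lt_of_le_of_lt (measure_mono interior_subset) Ω.isCompact.measure_lt_top⟩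

/-- `L^p(Ω)`. -/
abbrev LpScalar (Ω : TopologicalSpace.Compacts (Space d)) (p : ℝ) : Type :=
  Lp ℝ (ENNReal.ofReal p) (leb Ω)

/-- `L^p(Ω; ℝ^d)`. -/
abbrev LpVector (Ω : TopologicalSpace.Compacts (Space d)) (p : ℝ) : Type :=
  Lp (Space d) (ENNReal.ofReal p) (leb Ω)

/-- Test functions: smooth, with compact support inside the interior of `Ω`. -/
def IsTest (Ω : TopologicalSpace.Compacts (Space d)) (φ : Space d → ℝ) : Prop :=
  ContDiff ℝ ∞ φ ∧ HasCompactSupport φ ∧ tsupport φ ⊆ interior (Ω : Set (Space d))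

/-- `g` is the weak gradient of `u` on the interior of `Ω`. -/
def IsWeakGradient (Ω : TopologicalSpace.Compacts (Space d)) (u : Space d → ℝ)
    (g : Space d → Space d) : Prop :=
  ∀ φ : Space d → ℝ, IsTest Ω φ → ∀ v : Space d,
    ∫ x, u x * fderiv ℝ φ x v ∂(leb Ω) = - ∫ x, inner ℝ (g x) v * φ x ∂(leb Ω)

theorem integrable_mul_of_compact {Ω : TopologicalSpace.Compacts (Space d)} {p : ℝ}
    [Fact (1 ≤ ENNReal.ofReal p)] (u : LpScalar Ω p) {ψ : Space d → ℝ}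
    (hψ : Continuous ψ) (hs : HasCompactSupport ψ) :
    Integrable (fun x => u x * ψ x) (leb Ω) := by
  have hu : Integrable u (leb Ω) := (Lp.memLp u).integrable Fact.out
  obtain ⟨C, hC⟩ := hψ.bounded_above_of_compact_support hs
  exact hu.mul_bdd (c := C) hψ.aestronglyMeasurable (Filter.Eventually.of_forall hC)

theorem integrable_inner_mul_of_compact {Ω : TopologicalSpace.Compacts (Space d)} {p : ℝ}
    [Fact (1 ≤ ENNReal.ofReal p)] (g : LpVector Ω p) (v : Space d) {ψ : Space d → ℝ}
    (hψ : Continuous ψ) (hs : HasCompactSupport ψ) :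
    Integrable (fun x => inner ℝ (g x) v * ψ x) (leb Ω) := by
  have hu : Integrable g (leb Ω) := (Lp.memLp g).integrable Fact.out
  obtain ⟨C, hC⟩ := hψ.bounded_above_of_compact_support hs
  exact (hu.inner_const v).mul_bdd (c := C) hψ.aestronglyMeasurable
    (Filter.Eventually.of_forall hC)

theorem IsTest.continuous_fderiv {Ω : TopologicalSpace.Compacts (Space d)} {φ : Space d → ℝ}
    (h : IsTest Ω φ) (v : Space d) : Continuous (fun x => fderiv ℝ φ x v) :=
  (h.1.continuous_fderiv (by simp)).clm_apply continuous_const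

theorem IsTest.hasCompactSupport_fderiv {Ω : TopologicalSpace.Compacts (Space d)}
    {φ : Space d → ℝ} (h : IsTest Ω φ) (v : Space d) :
    HasCompactSupport (fun x => fderiv ℝ φ x v) :=
  h.2.1.fderiv_apply (𝕜 := ℝ) v

/-- The Sobolev space `W^{1,p}(Ω)`, realised as the space of all pairs `(u, ∇u)` in
`L^p(Ω) × L^p(Ω; ℝ^d)`. The norm is `max (‖u‖_p) (‖∇u‖_p)`, equivalent to the usual one. -/
def Sobolev (Ω : TopologicalSpace.Compacts (Space d)) (p : ℝ) [Fact (1 ≤ ENNReal.ofReal p)] :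
    Submodule ℝ (LpScalar Ω p × LpVector Ω p) where
  carrier := {u | IsWeakGradient Ω u.1 u.2}
  zero_mem' := by
    intro φ _ v
    have h1 : ∫ x, (((0 : LpScalar Ω p × LpVector Ω p).1 : LpScalar Ω p) : Space d → ℝ) x
        * fderiv ℝ φ x v ∂(leb Ω) = 0 := by
      apply integral_eq_zero_of_ae
      filter_upwards [Lp.coeFn_zero ℝ (ENNReal.ofReal p) (leb Ω)] with x hx
      have hx' : ((0 : LpScalar Ω p) : Space d → ℝ) x = 0 := hx
      rw [Prod.fst_zero, hx', zero_mul, Pi.zero_apply]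
    have h2 : ∫ x, inner ℝ ((((0 : LpScalar Ω p × LpVector Ω p).2 : LpVector Ω p) :
        Space d → Space d) x) v * φ x ∂(leb Ω) = 0 := by
      apply integral_eq_zero_of_ae
      filter_upwards [Lp.coeFn_zero (Space d) (ENNReal.ofReal p) (leb Ω)] with x hx
      have hx' : ((0 : LpVector Ω p) : Space d → Space d) x = 0 := hx
      rw [Prod.snd_zero, hx', inner_zero_left, zero_mul, Pi.zero_apply]
    rw [h1, h2, neg_zero]
  add_mem' := by
    intro a b ha hb φ hφ v
    have h1 : ∫ x, ((a + b).1 : LpScalar Ω p) x * fderiv ℝ φ x v ∂(leb Ω)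
        = ∫ x, (a.1 x * fderiv ℝ φ x v + b.1 x * fderiv ℝ φ x v) ∂(leb Ω) := by
      apply integral_congr_ae
      filter_upwards [Lp.coeFn_add a.1 b.1] with x hx
      rw [Prod.fst_add, hx, Pi.add_apply, add_mul]
    have h2 : ∫ x, inner ℝ (((a + b).2 : LpVector Ω p) x) v * φ x ∂(leb Ω)
        = ∫ x, (inner ℝ (a.2 x) v * φ x + inner ℝ (b.2 x) v * φ x) ∂(leb Ω) := by
      apply integral_congr_ae
      filter_upwards [Lp.coeFn_add a.2 b.2] with x hx
      rw [Prod.snd_add, hx, Pi.add_apply, inner_add_left, add_mul]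
    have c1 := hφ.continuous_fderiv v
    have c2 := hφ.hasCompactSupport_fderiv v
    have c3 := hφ.1.continuous
    rw [h1, h2, integral_add (integrable_mul_of_compact a.1 c1 c2)
      (integrable_mul_of_compact b.1 c1 c2),
      integral_add (integrable_inner_mul_of_compact a.2 v c3 hφ.2.1)
      (integrable_inner_mul_of_compact b.2 v c3 hφ.2.1), ha φ hφ v, hb φ hφ v]
    ring
  smul_mem' := by
    intro c a ha φ hφ v
    have h1 : ∫ x, ((c • a).1 : LpScalar Ω p) x * fderiv ℝ φ x v ∂(leb Ω)
        = ∫ x, c * (a.1 x * fderiv ℝ φ x v) ∂(leb Ω) := by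
      apply integral_congr_ae
      filter_upwards [Lp.coeFn_smul c a.1] with x hx
      rw [Prod.smul_fst, hx, Pi.smul_apply, smul_eq_mul, mul_assoc]
    have h2 : ∫ x, inner ℝ (((c • a).2 : LpVector Ω p) x) v * φ x ∂(leb Ω)
        = ∫ x, c * (inner ℝ (a.2 x) v * φ x) ∂(leb Ω) := by
      apply integral_congr_ae
      filter_upwards [Lp.coeFn_smul c a.2] with x hx
      rw [Prod.smul_snd, hx, Pi.smul_apply, real_inner_smul_left, mul_assoc]
    rw [h1, h2, integral_const_mul, integral_const_mul, ha φ hφ v]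
    ring

/-- The constant function `1` as an element of `W^{1,p}(Ω)`. -/
def sobolevOne (Ω : TopologicalSpace.Compacts (Space d)) (p : ℝ)
    [Fact (1 ≤ ENNReal.ofReal p)] : Sobolev Ω p :=
  ⟨(Lp.const (ENNReal.ofReal p) (leb Ω) (1 : ℝ), 0), by
    intro φ hφ v
    have h1 : ∫ x, (Lp.const (ENNReal.ofReal p) (leb Ω) (1 : ℝ) : LpScalar Ω p) x
        * fderiv ℝ φ x v ∂(leb Ω) = ∫ x, fderiv ℝ φ x v ∂(leb Ω) := by
      apply integral_congr_ae
      filter_upwards [Lp.coeFn_const (p := ENNReal.ofReal p) (μ := leb Ω) (1 : ℝ)] with x hx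
      rw [hx]; simp
    have h2 : ∫ x, inner ℝ (((0 : LpVector Ω p) : Space d → Space d) x) v * φ x ∂(leb Ω)
        = 0 := by
      apply integral_eq_zero_of_ae
      filter_upwards [Lp.coeFn_zero (Space d) (ENNReal.ofReal p) (leb Ω)] with x hx
      have hx' : ((0 : LpVector Ω p) : Space d → Space d) x = 0 := hx
      rw [hx', inner_zero_left, zero_mul, Pi.zero_apply]
    have h3 : ∫ x, fderiv ℝ φ x v ∂(leb Ω) = ∫ x, fderiv ℝ φ x v := by
      apply setIntegral_eq_integral_of_forall_compl_eq_zero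
      intro x hx
      have hx' : x ∉ tsupport φ := fun h => hx (hφ.2.2 h)
      have : fderiv ℝ φ x = 0 := by
        by_contra hne
        exact hx' (support_fderiv_subset ℝ hne)
      rw [this]; simp
    have h4 : ∫ x, fderiv ℝ φ x v = 0 := by
      have hi := (hφ.continuous_fderiv v).integrable_of_hasCompactSupport (μ := volume)
        (hφ.hasCompactSupport_fderiv v)
      have h0 := integral_mul_fderiv_eq_neg_fderiv_mul_of_integrable
        (μ := (volume : Measure (Space d))) (f := fun _ => (1 : ℝ)) (g := φ) (v := v)
        (by simp) (by simpa using hi)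
        (by simpa using hφ.1.continuous.integrable_of_hasCompactSupport (μ := volume) hφ.2.1)
        (by fun_prop) (fun x _ => (hφ.1.differentiable (by simp)) x)
      simpa using h0
    change ∫ x, (Lp.const (ENNReal.ofReal p) (leb Ω) (1 : ℝ) : LpScalar Ω p) x
        * fderiv ℝ φ x v ∂(leb Ω)
      = - ∫ x, inner ℝ (((0 : LpVector Ω p) : Space d → Space d) x) v * φ x ∂(leb Ω)
    rw [h1, h2, h3, h4, neg_zero]⟩

/-- The subspace of `W^{1,p}(Ω)` of functions with mean zero, as a space of pairs `(u, ∇u)`. -/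
def SobolevMeanZero (Ω : TopologicalSpace.Compacts (Space d)) (p : ℝ)
    [Fact (1 ≤ ENNReal.ofReal p)] : Submodule ℝ (LpScalar Ω p × LpVector Ω p) where
  carrier := {u | u ∈ Sobolev Ω p ∧ ∫ x, u.1 x ∂(leb Ω) = 0}
  zero_mem' := by
    refine ⟨(Sobolev Ω p).zero_mem, ?_⟩
    apply integral_eq_zero_of_ae
    exact Lp.coeFn_zero ℝ (ENNReal.ofReal p) (leb Ω)
  add_mem' := by
    intro a b ha hb
    refine ⟨(Sobolev Ω p).add_mem ha.1 hb.1, ?_⟩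
    have h : ∫ x, ((a + b).1 : LpScalar Ω p) x ∂(leb Ω) = ∫ x, (a.1 x + b.1 x) ∂(leb Ω) :=
      integral_congr_ae (Lp.coeFn_add a.1 b.1)
    rw [h, integral_add ((Lp.memLp a.1).integrable Fact.out)
      ((Lp.memLp b.1).integrable Fact.out), ha.2, hb.2, add_zero]
  smul_mem' := by
    intro c a ha
    refine ⟨(Sobolev Ω p).smul_mem c ha.1, ?_⟩
    have h : ∫ x, ((c • a).1 : LpScalar Ω p) x ∂(leb Ω) = ∫ x, c * a.1 x ∂(leb Ω) :=
      integral_congr_ae (Lp.coeFn_smul c a.1)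
    rw [h, integral_const_mul, ha.2, mul_zero]

/-- A mean-zero Sobolev function as an element of `W^{1,p}(Ω)`. -/
def meanZeroToSobolev {Ω : TopologicalSpace.Compacts (Space d)} {p : ℝ}
    [Fact (1 ≤ ENNReal.ofReal p)] (u : SobolevMeanZero Ω p) : Sobolev Ω p :=
  ⟨u.1, u.2.1⟩

/-- The gradient `∇` from mean-zero Sobolev functions to `L^p(Ω; ℝ^d)`. -/
def grad (Ω : TopologicalSpace.Compacts (Space d)) (p : ℝ) [Fact (1 ≤ ENNReal.ofReal p)] :
    SobolevMeanZero Ω p →L[ℝ] LpVector Ω p :=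
  (ContinuousLinearMap.snd ℝ (LpScalar Ω p) (LpVector Ω p)).comp (SobolevMeanZero Ω p).subtypeL

/-- The pairing `⟨div q, φ⟩ = -∫ q · ∇φ`, for `q ∈ L^p` and mean-zero `φ ∈ W^{1,p'}`. -/
def divPairing {Ω : TopologicalSpace.Compacts (Space d)} {p p' : ℝ}
    [Fact (1 ≤ ENNReal.ofReal p')]
    (q : LpVector Ω p) (φ : SobolevMeanZero Ω p') : ℝ :=
  - ∫ x, inner ℝ (q x) (grad Ω p' φ x) ∂(leb Ω)

/-- The functionals on `W^{1,p}(Ω)` that vanish at the constant function `1`. -/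
def DualPerp (Ω : TopologicalSpace.Compacts (Space d)) (p : ℝ) [Fact (1 ≤ ENNReal.ofReal p)] :
    Set (StrongDual ℝ (Sobolev Ω p)) :=
  {ν | ν (sobolevOne Ω p) = 0}

/-- Unique solvability of `div ∇y = ν` in mean-zero `W^{1,p'}(Ω)`, for every functional `ν` on
`W^{1,p}(Ω)` that vanishes at `1`. -/
def LaplaceSolvable (Ω : TopologicalSpace.Compacts (Space d)) (p p' : ℝ)
    [Fact (1 ≤ ENNReal.ofReal p)] [Fact (1 ≤ ENNReal.ofReal p')] : Prop :=
  ∀ ν ∈ DualPerp Ω p, ∃! y : SobolevMeanZero Ω p',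
    ∀ φ : SobolevMeanZero Ω p, divPairing (grad Ω p' y) φ = ν (meanZeroToSobolev φ)

/-! ### Integration of Sobolev functions against measures on `Ω` -/

/-- `c` is a continuous representative on the compact set `Ω` of the function `u`, which is given
almost everywhere on the interior of `Ω`. -/
def IsContinuousRep {Ω : TopologicalSpace.Compacts (Space d)} (u : Space d → ℝ)
    (c : C(Ω, ℝ)) : Prop :=
  ∀ᵐ x ∂(leb Ω), ∀ hx : x ∈ Ω, c ⟨x, hx⟩ = u x

open Classical in
/-- The continuous representative on `Ω` of `u` (`0` if there is none). -/
def continuousRep {Ω : TopologicalSpace.Compacts (Space d)} (u : Space d → ℝ) : C(Ω, ℝ) :=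
  if h : ∃ c : C(Ω, ℝ), IsContinuousRep u c then h.choose else 0

/-- `∫ φ dμ` with `μ = μ⁺ - μ⁻`, through the continuous representative of `φ`. -/
def measurePairing {Ω : TopologicalSpace.Compacts (Space d)} (μp μm : Measure Ω) {p : ℝ}
    [Fact (1 ≤ ENNReal.ofReal p)] (φ : SobolevMeanZero Ω p) : ℝ :=
  ∫ z, continuousRep φ.1.1 z ∂μp - ∫ z, continuousRep φ.1.1 z ∂μm

/-! ### The integrands -/

/-- `𝓕(x, p) = (ε/α') ((|p| - w(x))₊ / ε)^{α'}`. -/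
def calF (ε α' : ℝ) (w : Space d → ℝ) (x p : Space d) : ℝ :=
  ε / α' * ((1 / ε) * max (‖p‖ - w x) 0) ^ α'

/-- `𝓡(x, p) = δ max(|p|, w(x)) + (δ/2) min(|p|²/w(x), w(x))`. At points with `w x = 0` the
minimum is `0`, also with the convention `|p|²/0 = 0`. -/
def calR (δ : ℝ) (w : Space d → ℝ) (x p : Space d) : ℝ :=
  δ * max ‖p‖ (w x) + δ / 2 * min (‖p‖ ^ 2 / w x) (w x)

/-- `𝓖 = 𝓕 + 𝓡`. -/
def calG (ε δ α' : ℝ) (w : Space d → ℝ) (x p : Space d) : ℝ :=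
  calF ε α' w x p + calR δ w x p

/-- The Fenchel conjugate of `𝓖` in the second variable. -/
def calGConj (ε δ α' : ℝ) (w : Space d → ℝ) (x q : Space d) : EReal :=
  ⨆ p : Space d, ((inner ℝ q p - calG ε δ α' w x p : ℝ) : EReal)

/-- `∫ 𝓖(x, ξ(x)) dx`. -/
def intG (Ω : TopologicalSpace.Compacts (Space d)) (ε δ α' : ℝ) (w : Space d → ℝ)
    (ξ : LpVector Ω α') : ℝ :=
  ∫ x, calG ε δ α' w x (ξ x) ∂(leb Ω)

/-- `∫ 𝓖*(x, q(x)) dx`. -/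
def intGConj (Ω : TopologicalSpace.Compacts (Space d)) (ε δ α α' : ℝ) (w : Space d → ℝ)
    (q : LpVector Ω α) : ℝ :=
  ∫ x, (calGConj ε δ α' w x (q x)).toReal ∂(leb Ω)

/-! ### The two optimisation problems -/

/-- The objective `𝓙(y) = ∫ 𝓖(-∇y) - ∫ y dμ`, on mean-zero `W^{1,α'}(Ω)`. -/
def calJ {Ω : TopologicalSpace.Compacts (Space d)} (ε δ α' : ℝ) [Fact (1 ≤ ENNReal.ofReal α')]
    (w : Space d → ℝ) (μp μm : Measure Ω) (y : SobolevMeanZero Ω α') : ℝ :=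
  intG Ω ε δ α' w (-(grad Ω α' y)) - measurePairing μp μm y

/-- `div q = μ`. -/
def Feasible {Ω : TopologicalSpace.Compacts (Space d)} {α : ℝ} (α' : ℝ)
    [Fact (1 ≤ ENNReal.ofReal α')] (μp μm : Measure Ω) (q : LpVector Ω α) : Prop :=
  ∀ φ : SobolevMeanZero Ω α', divPairing q φ = measurePairing μp μm φ

/-- `f(y) = -∫ y dμ`. -/
def fPart {Ω : TopologicalSpace.Compacts (Space d)} {α' : ℝ} [Fact (1 ≤ ENNReal.ofReal α')]
    (μp μm : Measure Ω) (y : SobolevMeanZero Ω α') : EReal :=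
  ((-(measurePairing μp μm y) : ℝ) : EReal)

/-- `g(ξ) = ∫ 𝓖(ξ)`. -/
def gPart {Ω : TopologicalSpace.Compacts (Space d)} (ε δ : ℝ) {α' : ℝ} (w : Space d → ℝ)
    (ξ : LpVector Ω α') : EReal :=
  ((intG Ω ε δ α' w ξ : ℝ) : EReal)

/-- `A = -∇`. -/
def negGrad (Ω : TopologicalSpace.Compacts (Space d)) (p : ℝ) [Fact (1 ≤ ENNReal.ofReal p)] :
    SobolevMeanZero Ω p →L[ℝ] LpVector Ω p :=
  -(grad Ω p)

open Classical in
/-- `∫ 𝓖*(q)` for feasible densities `q ∈ L^α(Ω; ℝ^d)`, and `+∞` for the others. -/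
def beckmannObjective {Ω : TopologicalSpace.Compacts (Space d)} (ε δ α α' : ℝ)
    [Fact (1 ≤ ENNReal.ofReal α')] (w : Space d → ℝ) (μp μm : Measure Ω)
    (q : LpVector Ω α) : EReal :=
  if Feasible α' μp μm q then ((intGConj Ω ε δ α α' w q : ℝ) : EReal) else ⊤

/-! ### Fenchel duality in Banach spaces -/

section Fenchel

variable {X Y : Type} [NormedAddCommGroup X] [NormedSpace ℝ X]
  [NormedAddCommGroup Y] [NormedSpace ℝ Y]

/-- The Fenchel conjugate of `f : X → [-∞, ∞]`, a function on the topological dual of `X`. -/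
def fenchelConj (f : X → EReal) (l : StrongDual ℝ X) : EReal :=
  ⨆ x, ((l x : ℝ) : EReal) - f x

/-- The objective of the Fenchel primal problem `inf_x f(x) + g(A x)`. -/
def fenchelPrimal (f : X → EReal) (g : Y → EReal) (A : X →L[ℝ] Y) (x : X) : EReal :=
  f x + g (A x)

/-- The objective of the Fenchel dual problem `sup_ν -f*(A* ν) - g*(-ν)`. -/
def fenchelDual (f : X → EReal) (g : Y → EReal) (A : X →L[ℝ] Y) (ν : StrongDual ℝ Y) : EReal :=
  - fenchelConj f (ν.comp A) - fenchelConj g (-ν)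

end Fenchel

end Beckmann

end

/-! ### The dual of `L^p` on a finite measure space -/

section LpDual

open Filter Topology

variable {X : Type*} [MeasurableSpace X] {μ : Measure X} {P : ℝ≥0∞}

/-! The dual problem is solved first, and the primal minimizer is read off from its optimality
condition. Since `𝓖*(x, q)` grows like `|q|^α`, the direct method gives a feasible `q` minimizing `∫
𝓖*(x, q)` (`exists_minimizer_intGConj`). Put `ξ(x) = ∇_q 𝓖*(x, q(x))`, which is `conjGrad`. Varying
`q` by fields `r` that annihilate all gradients shows that each such `r` annihilates `ξ`
(`conjGrad_variation`). Gradients form a closed subspace of `L^α'`, so `ξ = ∇y` for some mean-zero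
`y`. Equality in Fenchel–Young then gives `𝓙(-y) = -∫ 𝓖*(x, q)`, and weak duality makes `-y` optimal
with no gap (`exists_calJ_eq_neg_intGConj`).

Four ingredients feed this argument. Pointwise convex analysis: the Fenchel–Young inequality
`inner_sub_calG_le` and its equality case `inner_conjGrad_sub_calG` identify `𝓖*`. Because the
maximizer `conjGrad` is explicit and maps `L^α` to `L^α'`, the conjugate of the integral is the
integral of the conjugate, without a measurable selection. Riesz representation:
`existsUnique_dual_eq_integral_inner` turns functionals on `L^α'` into fields in `L^α`. This gives
the form of the dual problem, and lets weak-* compactness produce `q`. Morrey's estimate: `α(d-1) <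
d` says exactly `α' > d`, so Sobolev functions on a Lipschitz domain have continuous representatives
(`exists_isContinuousRep`). With the closed graph theorem, `y ↦ ∫ y dμ` becomes a continuous
functional. The Poincaré inequality `exists_norm_le_norm_grad`: it follows from the solvability
assumption on the Laplace equation. It makes the range of `∇` closed, and with Hahn–Banach it yields
a feasible `q`. -/

theorem norm_toLp_rpow {E : Type*} [NormedAddCommGroup E] {p : ℝ} (hp : 0 < p) {f : X → E}
    (hf : MemLp f (ENNReal.ofReal p) μ) :
    ‖hf.toLp f‖ = (∫ x, ‖f x‖ ^ p ∂μ) ^ (1 / p) := by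
  rw [Lp.norm_toLp, hf.eLpNorm_eq_integral_rpow_norm (by simpa using hp) (by simp),
    ENNReal.toReal_ofReal, ENNReal.toReal_ofReal hp.le, one_div]
  exact Real.rpow_nonneg (integral_nonneg fun x => Real.rpow_nonneg (norm_nonneg _) _) _

variable [IsFiniteMeasure μ]

theorem sum_indicatorConstLp {E : Type*} [NormedAddCommGroup E] (c : E) {f : ℕ → Set X}
    (hf : ∀ i, MeasurableSet (f i)) (hd : Pairwise (Function.onFun Disjoint f)) (F : Finset ℕ) :
    ∑ i ∈ F, indicatorConstLp P (hf i) (measure_ne_top μ _) c =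
      indicatorConstLp P (F.measurableSet_biUnion fun i _ => hf i) (measure_ne_top μ _) c := by
  classical
  induction F using Finset.induction_on with
  | empty => simp
  | insert a F ha ih =>
    rw [Finset.sum_insert ha, ih, ← indicatorConstLp_disjoint_union]
    · simp
    · rw [Set.disjoint_iUnion₂_right]
      intro i hi
      exact hd (fun h => ha (h ▸ hi))

theorem indicatorConstLp_eq_sum_single {ι : Type*} [Fintype ι] [DecidableEq ι] {s : Set X}
    (hs : MeasurableSet s) (c : EuclideanSpace ℝ ι) :
    indicatorConstLp P hs (measure_ne_top μ _) c =
      ∑ i, c i • indicatorConstLp P hs (measure_ne_top μ _) (EuclideanSpace.single i (1 : ℝ)) := by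
  let L : EuclideanSpace ℝ ι →ₗ[ℝ] Lp (EuclideanSpace ℝ ι) P μ :=
    { toFun := fun c => indicatorConstLp P hs (measure_ne_top μ _) c
      map_add' := fun a b => indicatorConstLp_add.symm
      map_smul' := fun a b => by
        simp only [indicatorConstLp, indicator_const_smul, RingHom.id_apply]
        exact MemLp.toLp_const_smul a _ }
  have h : c = ∑ i, c i • EuclideanSpace.single i (1 : ℝ) := by
    ext j
    simp [Finset.sum_apply, Pi.single_apply]
  have h2 : L c = ∑ i, c i • L (EuclideanSpace.single i (1 : ℝ)) := by
    conv_lhs => rw [h]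
    simp only [map_sum, map_smul]
  exact h2

variable [Fact (1 ≤ P)]

/-- The symmetric difference is covered by the `f i` with `i ∉ F`, whose measures sum to a tail of a
convergent series. The limit is along finite sets because countable additivity of a signed measure
is unconditional summability. -/
theorem tendsto_measure_biUnion_symmDiff {f : ℕ → Set X}
    (hf : ∀ i, MeasurableSet (f i)) (hd : Pairwise (Function.onFun Disjoint f)) :
    Tendsto (fun F : Finset ℕ => μ (symmDiff (⋃ i ∈ F, f i) (⋃ i, f i))) atTop (𝓝 0) := by
  have hs : ∑' i, μ (f i) ≠ ⊤ := by
    rw [← measure_iUnion hd hf]; exact measure_ne_top μ _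
  refine tendsto_of_tendsto_of_tendsto_of_le_of_le tendsto_const_nhds
    (ENNReal.tendsto_tsum_compl_atTop_zero hs) (fun _ => zero_le) (fun F => ?_)
  refine (measure_mono ?_).trans (measure_iUnion_le (fun b : {x // x ∉ F} => f b))
  rintro x (⟨h1, h2⟩ | ⟨h1, h2⟩)
  · simp only [mem_iUnion] at h1 h2
    obtain ⟨i, _, hx⟩ := h1
    exact absurd ⟨i, hx⟩ h2
  · simp only [mem_iUnion, not_exists] at h1 h2 ⊢
    obtain ⟨i, hx⟩ := h1
    exact ⟨⟨i, fun hi => h2 i hi hx⟩, hx⟩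

open Classical in
/-- The signed measure `s ↦ ν (c · 1_s)` of a functional `ν` on `L^p`. -/
noncomputable def signedMeasureOfDual {E : Type*} [NormedAddCommGroup E] [NormedSpace ℝ E]
    (hP : P ≠ ⊤) (ν : StrongDual ℝ (Lp E P μ)) (c : E) : SignedMeasure X where
  measureOf' s := if h : MeasurableSet s then
    ν (indicatorConstLp P h (measure_ne_top μ _) c) else 0
  empty' := by simp
  not_measurable' s h := dif_neg h
  m_iUnion' f hf hd := by
    simp only [hf, MeasurableSet.iUnion hf, dif_pos]
    have : (fun F : Finset ℕ => ∑ i ∈ F, ν (indicatorConstLp P (hf i) (measure_ne_top μ _) c)) =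
        fun F => ν (indicatorConstLp P (F.measurableSet_biUnion fun i _ => hf i)
          (measure_ne_top μ _) c) := by
      funext F
      rw [← map_sum, sum_indicatorConstLp c hf hd]
    rw [HasSum]
    simp only [SummationFilter.unconditional_filter]
    rw [this]
    exact (ν.continuous.tendsto _).comp
      (tendsto_indicatorConstLp_set hP (tendsto_measure_biUnion_symmDiff hf hd))

theorem signedMeasureOfDual_apply {E : Type*} [NormedAddCommGroup E] [NormedSpace ℝ E]
    (hP : P ≠ ⊤) (ν : StrongDual ℝ (Lp E P μ)) (c : E) {s : Set X} (hs : MeasurableSet s) :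
    signedMeasureOfDual hP ν c s = ν (indicatorConstLp P hs (measure_ne_top μ _) c) :=
  dif_pos hs

/-- Radon–Nikodym: the indicator of a null set is zero in `L^P`, so the signed measure is absolutely
continuous. The density is only known to be in `L¹` at this point. -/
theorem exists_integrable_density_of_dual {E : Type*} [NormedAddCommGroup E] [NormedSpace ℝ E]
    (hP : P ≠ ⊤) (ν : StrongDual ℝ (Lp E P μ)) (c : E) :
    ∃ h : X → ℝ, Measurable h ∧ Integrable h μ ∧ ∀ (s : Set X) (hs : MeasurableSet s),
      ν (indicatorConstLp P hs (measure_ne_top μ _) c) = ∫ x in s, h x ∂μ := by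
  set m := signedMeasureOfDual hP ν c with hm
  have hac : m ≪ᵥ μ.toENNRealVectorMeasure := by
    refine VectorMeasure.AbsolutelyContinuous.mk fun s hs h0 => ?_
    rw [Measure.toENNRealVectorMeasure_apply_measurable hs] at h0
    have h1 : indicatorConstLp P hs (measure_ne_top μ _) c = 0 := by
      rw [Lp.eq_zero_iff_ae_eq_zero]
      refine indicatorConstLp_coeFn.trans ?_
      have : ∀ᵐ x ∂μ, x ∉ s := measure_eq_zero_iff_ae_notMem.1 h0
      filter_upwards [this] with x hx
      simp [hx]
    rw [hm, signedMeasureOfDual_apply hP ν c hs, h1, map_zero]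
  refine ⟨m.rnDeriv μ, m.measurable_rnDeriv μ, m.integrable_rnDeriv μ, fun s hs => ?_⟩
  rw [← withDensityᵥ_apply (m.integrable_rnDeriv μ) hs,
    m.withDensityᵥ_rnDeriv_eq μ hac, hm, signedMeasureOfDual_apply hP ν c hs]

theorem exists_vector_density_of_dual {ι : Type*} [Fintype ι]
    (hP : P ≠ ⊤) (ν : StrongDual ℝ (Lp (EuclideanSpace ℝ ι) P μ)) :
    ∃ h : X → EuclideanSpace ℝ ι, Measurable h ∧ Integrable h μ ∧
      ∀ (c : EuclideanSpace ℝ ι) (s : Set X) (hs : MeasurableSet s),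
      ν (indicatorConstLp P hs (measure_ne_top μ _) c) = ∫ x in s, inner ℝ (h x) c ∂μ := by
  classical
  choose h h1 h2 h3 using fun i : ι =>
    exists_integrable_density_of_dual hP ν (EuclideanSpace.single i (1 : ℝ))
  have hm : Measurable (fun x => WithLp.toLp 2 (fun i => h i x)) :=
    (WithLp.measurable_toLp 2 _).comp (measurable_pi_lambda _ h1)
  refine ⟨fun x => WithLp.toLp 2 (fun i => h i x), hm, ?_, fun c s hs => ?_⟩
  · exact Integrable.of_eval_piLp h2
  · rw [indicatorConstLp_eq_sum_single hs c, map_sum]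
    simp only [map_smul, h3 _ s hs, smul_eq_mul]
    simp only [PiLp.inner_apply]
    rw [integral_finsetSum]
    · simp [integral_const_mul]
    · intro i _
      simpa using ((h2 i).integrableOn (s := s)).const_mul (c i)

variable {ι : Type*} [Fintype ι] {p q : ℝ}

/-- Both sides are continuous in `ξ`, the right one by Hölder because `h ∈ L^Q`, and simple
functions are dense for `P ≠ ⊤`. -/
theorem dual_eq_integral_of_indicator {P Q : ℝ≥0∞} [Fact (1 ≤ P)] [Fact (1 ≤ Q)]
    [Q.HolderConjugate P] (hP : P ≠ ⊤)
    (ν : StrongDual ℝ (Lp (EuclideanSpace ℝ ι) P μ)) {h : X → EuclideanSpace ℝ ι}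
    (hh : MemLp h Q μ)
    (hν : ∀ (c : EuclideanSpace ℝ ι) (s : Set X) (hs : MeasurableSet s),
      ν (indicatorConstLp P hs (measure_ne_top μ _) c) = ∫ x in s, inner ℝ (h x) c ∂μ)
    (ξ : Lp (EuclideanSpace ℝ ι) P μ) : ν ξ = ∫ x, inner ℝ (h x) (ξ x) ∂μ := by
  have key : ∀ ξ : Lp (EuclideanSpace ℝ ι) P μ,
      (innerSL ℝ).lpPairing μ Q P (hh.toLp h) ξ = ∫ x, inner ℝ (h x) (ξ x) ∂μ := by
    intro ξ
    rw [ContinuousLinearMap.lpPairing_eq_integral]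
    refine integral_congr_ae ?_
    filter_upwards [hh.coeFn_toLp] with x hx
    rw [hx]; rfl
  rw [← key]
  refine Lp.induction hP (motive := fun ξ => ν ξ = (innerSL ℝ).lpPairing μ Q P (hh.toLp h) ξ)
    ?_ ?_ ?_ ξ
  · intro c s hs hμs
    rw [Lp.simpleFunc.coe_indicatorConst]
    rw [hν c s hs, key, ← integral_indicator hs]
    refine integral_congr_ae ?_
    filter_upwards [indicatorConstLp_coeFn (p := P) (hs := hs) (hμs := hμs.ne) (c := c)] with x hx
    rw [hx]
    by_cases hxs : x ∈ s <;> simp [hxs]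
  · intro f g hf hg _ h1 h2
    rw [map_add, map_add, h1, h2]
  · exact isClosed_eq ν.continuous (ContinuousLinearMap.continuous _)

theorem inner_norm_rpow_smul (hq : 1 < q) (v : EuclideanSpace ℝ ι) :
    inner ℝ v (‖v‖ ^ (q - 2) • v) = ‖v‖ ^ q := by
  rw [real_inner_smul_right, real_inner_self_eq_norm_sq]
  rcases eq_or_ne v 0 with rfl | hv
  · simp [Real.zero_rpow (by linarith : q ≠ 0)]
  · have : 0 < ‖v‖ := norm_pos_iff.2 hv
    rw [← Real.rpow_natCast, ← Real.rpow_add this]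
    congr 1; push_cast; ring

theorem norm_norm_rpow_smul (hq : 1 < q) (v : EuclideanSpace ℝ ι) :
    ‖‖v‖ ^ (q - 2) • v‖ = ‖v‖ ^ (q - 1) := by
  rw [norm_smul, Real.norm_of_nonneg (by positivity)]
  rcases eq_or_ne v 0 with rfl | hv
  · simp [Real.zero_rpow (by linarith : q - 1 ≠ 0)]
  · have : 0 < ‖v‖ := norm_pos_iff.2 hv
    nth_rewrite 2 [← Real.rpow_one ‖v‖]
    rw [← Real.rpow_add this]
    congr 1; ring

/-- Dividing by `I^(1/p)` leaves `I^(1/q) ≤ N`. The a priori finiteness of `I` is what forces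
truncation where this is applied. -/
theorem le_rpow_of_le_mul_rpow (hpq : p.HolderConjugate q) {I N : ℝ} (hI : 0 ≤ I) (hN : 0 ≤ N)
    (h : I ≤ N * I ^ (1 / p)) : I ≤ N ^ q := by
  rcases hI.eq_or_lt with rfl | hI
  · positivity
  · have h1 : I ^ (1 / q) ≤ N := by
      have e : I = I ^ (1 / q) * I ^ (1 / p) := by
        rw [← Real.rpow_add hI]
        have := hpq.inv_add_inv_eq_one
        rw [one_div, one_div, add_comm, this, Real.rpow_one]
      have h2 : I ^ (1 / q) * I ^ (1 / p) ≤ N * I ^ (1 / p) := by rw [← e]; exact h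
      exact le_of_mul_le_mul_right h2 (by positivity)
    have := Real.rpow_le_rpow (by positivity) h1 hpq.symm.nonneg
    rwa [← Real.rpow_mul hI.le, one_div, inv_mul_cancel₀ hpq.symm.ne_zero, Real.rpow_one] at this

end LpDual

/-! ### The `L^q` bound for the density, and Riesz representation. -/

section LpDual

open Filter Topology

variable {X : Type*} [MeasurableSpace X] {μ : Measure X} [IsFiniteMeasure μ]
  {ι : Type*} [Fintype ι] {p q : ℝ}

/-- Test `ν` with `‖h‖^(q-2) h` cut off to `A = {‖h‖ ≤ R}`: if `I` is the integral in question, then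
`ν` takes the value `I` at this function, whose `L^p` norm is `I^(1/p)`. The resulting bound does
not depend on `R`. -/
theorem integral_norm_rpow_le_of_dual (hpq : p.HolderConjugate q)
    [Fact (1 ≤ ENNReal.ofReal p)]
    (ν : StrongDual ℝ (Lp (EuclideanSpace ℝ ι) (ENNReal.ofReal p) μ))
    {h : X → EuclideanSpace ℝ ι} (hm : Measurable h)
    (hν : ∀ (c : EuclideanSpace ℝ ι) (s : Set X) (hs : MeasurableSet s),
      ν (indicatorConstLp (ENNReal.ofReal p) hs (measure_ne_top μ _) c) =
        ∫ x in s, inner ℝ (h x) c ∂μ)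
    (R : ℝ) : ∫ x in {x | ‖h x‖ ≤ R}, ‖h x‖ ^ q ∂μ ≤ ‖ν‖ ^ q := by
  have hq := hpq.symm.lt
  have : Fact (1 ≤ ENNReal.ofReal q) := ⟨by simpa using hq.le⟩
  have : (ENNReal.ofReal p).HolderConjugate (ENNReal.ofReal q) := hpq.ennrealOfReal
  have : (ENNReal.ofReal q).HolderConjugate (ENNReal.ofReal p) := hpq.symm.ennrealOfReal
  set A := {x | ‖h x‖ ≤ R} with hA
  have hAm : MeasurableSet A := measurableSet_le hm.norm measurable_const
  have hbd : ∀ x, ‖A.indicator h x‖ ≤ max R 0 := fun x => by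
    by_cases hx : x ∈ A
    · rw [indicator_of_mem hx]; exact le_max_of_le_left hx
    · simp [hx]
  have hmem : MemLp (A.indicator h) (ENNReal.ofReal q) μ :=
    MemLp.of_bound (hm.indicator hAm).aestronglyMeasurable _ (Eventually.of_forall hbd)
  set χ : Lp ℝ ⊤ μ := indicatorConstLp ⊤ hAm (measure_ne_top μ _) 1
  -- `T` multiplies by the indicator of `A`. The functional `ν ∘ T` has the bounded density `1_A h`,
  -- so it is represented on all of `L^p` before `h ∈ L^q` is known.
  set T := (ContinuousLinearMap.lsmul ℝ ℝ (E := EuclideanSpace ℝ ι)).holderL μ ⊤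
    (ENNReal.ofReal p) (ENNReal.ofReal p) χ
  have hT : ∀ ξ, T ξ =ᵐ[μ] A.indicator ξ := fun ξ => by
    have h1 : T ξ =ᵐ[μ] fun x => χ x • ξ x := ContinuousLinearMap.coeFn_holder _ _ _
    filter_upwards [h1, indicatorConstLp_coeFn (p := ⊤) (hs := hAm)
      (hμs := measure_ne_top μ _) (c := (1 : ℝ))] with x h1 h2
    rw [h1, h2]
    by_cases hx : x ∈ A <;> simp [hx]
  have h1 := dual_eq_integral_of_indicator (Q := ENNReal.ofReal q) (by simp) (ν.comp T) hmem
    (fun c s hs => by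
      have e : T (indicatorConstLp (ENNReal.ofReal p) hs (measure_ne_top μ _) c) =
          indicatorConstLp (ENNReal.ofReal p) (hAm.inter hs) (measure_ne_top μ _) c := by
        apply Lp.ext
        filter_upwards [hT (indicatorConstLp (ENNReal.ofReal p) hs (measure_ne_top μ _) c),
          indicatorConstLp_coeFn (p := ENNReal.ofReal p) (hs := hs)
            (hμs := measure_ne_top μ _) (c := c),
          indicatorConstLp_coeFn (p := ENNReal.ofReal p) (hs := hAm.inter hs)
            (hμs := measure_ne_top μ _) (c := c)] with x h1 h2 h3
        rw [h1, h3, Set.inter_comm, ← indicator_indicator]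
        by_cases hx : x ∈ A <;> by_cases hxs : x ∈ s <;> simp [hx, hxs, h2]
      rw [ContinuousLinearMap.comp_apply, e, hν, ← integral_indicator hs,
        ← integral_indicator (hAm.inter hs)]
      refine integral_congr_ae (Eventually.of_forall fun x => ?_)
      by_cases hx : x ∈ A <;> by_cases hxs : x ∈ s <;> simp [hx, hxs])
  set ξ : X → EuclideanSpace ℝ ι := A.indicator fun x => ‖h x‖ ^ (q - 2) • h x with hξ
  have hξn : ∀ x, ‖ξ x‖ = A.indicator (fun x => ‖h x‖ ^ (q - 1)) x := fun x => by
    by_cases hx : x ∈ A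
    · simp only [hξ, indicator_of_mem hx]; exact norm_norm_rpow_smul hq _
    · simp [hξ, hx]
  have hξm : MemLp ξ (ENNReal.ofReal p) μ := by
    refine MemLp.of_bound (C := (max R 0) ^ (q - 1)) ?_ (Eventually.of_forall fun x => ?_)
    · exact (((hm.norm.pow_const (q - 2)).smul hm).indicator hAm).aestronglyMeasurable
    · rw [hξn]
      by_cases hx : x ∈ A
      · rw [indicator_of_mem hx]
        exact Real.rpow_le_rpow (norm_nonneg _) (le_max_of_le_left hx) (by linarith)
      · rw [indicator_of_notMem hx]; positivity
  have hTξ : T (hξm.toLp ξ) = hξm.toLp ξ := by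
    apply Lp.ext
    filter_upwards [hT (hξm.toLp ξ), hξm.coeFn_toLp] with x h1 h2
    rw [h1]
    by_cases hx : x ∈ A
    · simp [hx]
    · rw [indicator_of_notMem hx, h2, hξ, indicator_of_notMem hx]
  have h2 := h1 (hξm.toLp ξ)
  rw [ContinuousLinearMap.comp_apply, hTξ] at h2
  have h3 : ∫ x, inner ℝ (A.indicator h x) (hξm.toLp ξ x) ∂μ = ∫ x in A, ‖h x‖ ^ q ∂μ := by
    rw [← integral_indicator hAm]
    refine integral_congr_ae ?_
    filter_upwards [hξm.coeFn_toLp] with x hx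
    rw [hx]
    by_cases hx : x ∈ A
    · simp only [hξ, indicator_of_mem hx]; exact inner_norm_rpow_smul hq _
    · simp [hx]
  have h4 : ∫ x, ‖ξ x‖ ^ p ∂μ = ∫ x in A, ‖h x‖ ^ q ∂μ := by
    rw [← integral_indicator hAm]
    refine integral_congr_ae (Eventually.of_forall fun x => ?_)
    simp only [hξn]
    by_cases hx : x ∈ A
    · simp only [indicator_of_mem hx]
      rw [← Real.rpow_mul (norm_nonneg _), hpq.symm.sub_one_mul_conj]
    · simp [hx, Real.zero_rpow hpq.ne_zero]
  refine le_rpow_of_le_mul_rpow hpq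
    (integral_nonneg fun x => Real.rpow_nonneg (norm_nonneg _) _) (norm_nonneg _) ?_
  rw [← h3, ← h2]
  refine (le_abs_self _).trans ((ν.le_opNorm _).trans ?_)
  rw [norm_toLp_rpow hpq.pos, h4]
  rw [h2, h3]

/-- The dual of `L^p(μ; ℝ^n)` is `L^q(μ; ℝ^n)`. -/
theorem existsUnique_dual_eq_integral_inner (hpq : p.HolderConjugate q)
    [Fact (1 ≤ ENNReal.ofReal p)] [Fact (1 ≤ ENNReal.ofReal q)]
    (ν : StrongDual ℝ (Lp (EuclideanSpace ℝ ι) (ENNReal.ofReal p) μ)) :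
    ∃! h : Lp (EuclideanSpace ℝ ι) (ENNReal.ofReal q) μ, ∀ ξ, ν ξ = ∫ x, inner ℝ (h x) (ξ x) ∂μ := by
  have : (ENNReal.ofReal q).HolderConjugate (ENNReal.ofReal p) := hpq.symm.ennrealOfReal
  have hq := hpq.symm.lt
  obtain ⟨h, hm, hi, hν⟩ := exists_vector_density_of_dual (by simp) ν
  have hint : Integrable (fun x => ‖h x‖ ^ q) μ := by
    -- The truncation sets exhaust the space, so the bounds uniform in `R` give integrability of
    -- `‖h‖^q`.
    have hc : AECover μ atTop (fun n : ℕ => {x | ‖h x‖ ≤ (n : ℝ)}) :=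
      { ae_eventually_mem := Eventually.of_forall fun x =>
          (eventually_ge_atTop ⌈‖h x‖⌉₊).mono fun n hn => Nat.ceil_le.1 hn
        measurableSet := fun n => measurableSet_le hm.norm measurable_const }
    refine hc.integrable_of_integral_norm_bounded (‖ν‖ ^ q) (fun n => ?_)
      (Eventually.of_forall fun n => ?_)
    · refine Measure.integrableOn_of_bounded (M := (n : ℝ) ^ q) (measure_ne_top μ _)
        (hm.norm.pow_const q).aestronglyMeasurable ?_
      refine (ae_restrict_mem (hc.measurableSet n)).mono fun x hx => ?_
      rw [Real.norm_of_nonneg (by positivity)]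
      exact Real.rpow_le_rpow (norm_nonneg _) hx (by linarith)
    · simp only [Real.norm_of_nonneg (Real.rpow_nonneg (norm_nonneg _) q)]
      exact integral_norm_rpow_le_of_dual hpq ν hm hν n
  have hh : MemLp h (ENNReal.ofReal q) μ := by
    rw [← integrable_norm_rpow_iff hm.aestronglyMeasurable (by simpa using hpq.symm.pos) (by simp),
      ENNReal.toReal_ofReal hpq.symm.nonneg]
    exact hint
  refine ⟨hh.toLp h, fun ξ => ?_, fun g hg => ?_⟩
  · rw [dual_eq_integral_of_indicator (Q := ENNReal.ofReal q) (by simp) ν hh hν]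
    refine integral_congr_ae ?_
    filter_upwards [hh.coeFn_toLp] with x hx
    rw [hx]
  · apply Lp.ext
    refine Filter.EventuallyEq.trans ?_ hh.coeFn_toLp.symm
    have hgi : Integrable g μ := (Lp.memLp g).integrable Fact.out
    -- Uniqueness: the values of `ν` at `c · 1_s` fix all set integrals of the density.
    refine Integrable.ae_eq_of_forall_setIntegral_eq _ _ hgi hi fun s hs _ => ?_
    refine ext_inner_right ℝ fun c => ?_
    rw [real_inner_comm, ← integral_inner hgi.integrableOn, real_inner_comm,
      ← integral_inner hi.integrableOn]
    have h1 := hν c s hs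
    rw [hg] at h1
    simp only [real_inner_comm _ c] at h1 ⊢
    rw [← h1, ← integral_indicator hs]
    refine integral_congr_ae ?_
    filter_upwards [indicatorConstLp_coeFn (p := ENNReal.ofReal p) (hs := hs)
      (hμs := measure_ne_top μ _) (c := c)] with x hx
    rw [hx]
    by_cases hxs : x ∈ s <;> simp [hxs]

end LpDual

namespace Beckmann

/-! ### Contracting a weight towards a point: differentiation in the scale. -/

section Morrey

open Filter Topology

variable {d : ℕ}

/-- The mass preserving contraction of the weight `η` towards the point `x` by the factor `s`. -/
noncomputable def contractedWeight (η : Space d → ℝ) (x : Space d) (s : ℝ) (z : Space d) : ℝ :=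
  s ^ d * η (x + s • (z - x))

/-- The derivative of `contractedWeight η x s z` with respect to `s`. -/
noncomputable def contractedWeightDeriv (η : Space d → ℝ) (x : Space d) (s : ℝ) (z : Space d) :
    ℝ :=
  d * s ^ (d - 1) * η (x + s • (z - x)) + s ^ d * fderiv ℝ η (x + s • (z - x)) (z - x)

variable {η : Space d → ℝ}

theorem hasDerivAt_contractedWeight (hη : ContDiff ℝ ∞ η) (x z : Space d) (s : ℝ) :
    HasDerivAt (fun s => contractedWeight η x s z) (contractedWeightDeriv η x s z) s := by
  have h1 : HasDerivAt (fun s : ℝ => x + s • (z - x)) (z - x) s := by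
    simpa using ((hasDerivAt_id s).smul_const (z - x)).const_add x
  have h2 : HasDerivAt (fun s : ℝ => η (x + s • (z - x)))
      (fderiv ℝ η (x + s • (z - x)) (z - x)) s :=
    ((hη.differentiable (by simp)) _).hasFDerivAt.comp_hasDerivAt s h1
  exact (hasDerivAt_pow d s).mul h2

theorem continuous_contractedWeight (hη : ContDiff ℝ ∞ η) (x : Space d) (s : ℝ) :
    Continuous (contractedWeight η x s) := by
  unfold contractedWeight
  have := hη.continuous
  fun_prop

theorem continuous_contractedWeightDeriv (hη : ContDiff ℝ ∞ η) (x : Space d) :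
    Continuous (fun y : ℝ × Space d => contractedWeightDeriv η x y.1 y.2) := by
  unfold contractedWeightDeriv
  have h1 := hη.continuous
  have h2 : Continuous (fderiv ℝ η) := hη.continuous_fderiv (by simp)
  have h3 : Continuous (fun y : ℝ × Space d => fderiv ℝ η (x + y.1 • (y.2 - x)) (y.2 - x)) :=
    (h2.comp (by fun_prop)).clm_apply (by fun_prop)
  fun_prop

theorem fderiv_coord_mul_contractedWeight (hη : ContDiff ℝ ∞ η) (x z : Space d) (s : ℝ)
    (i : Fin d) :
    fderiv ℝ (fun z => (z - x) i * contractedWeight η x s z) z (EuclideanSpace.single i 1) =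
      s ^ d * η (x + s • (z - x)) + (z - x) i *
        (s ^ d * (s * fderiv ℝ η (x + s • (z - x)) (EuclideanSpace.single i 1))) := by
  have h1 : HasFDerivAt (fun z : Space d => x + s • (z - x))
      (s • ContinuousLinearMap.id ℝ (Space d)) z :=
    (((hasFDerivAt_id z).sub_const x).const_smul s).const_add x
  have h2 : HasFDerivAt (fun z : Space d => contractedWeight η x s z)
      (s ^ d • (fderiv ℝ η (x + s • (z - x))).comp (s • ContinuousLinearMap.id ℝ (Space d))) z :=
    (((hη.differentiable (by simp)) _).hasFDerivAt.comp z h1).const_mul (s ^ d)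
  have h3 : HasFDerivAt (fun z : Space d => (z - x) i)
      (EuclideanSpace.proj i : Space d →L[ℝ] ℝ) z := by
    have := (EuclideanSpace.proj i : Space d →L[ℝ] ℝ).hasFDerivAt.comp z
      ((hasFDerivAt_id z).sub_const x)
    rwa [ContinuousLinearMap.comp_id] at this
  have h4 : HasFDerivAt (fun z => (z - x) i * contractedWeight η x s z) _ z := h3.mul h2
  rw [h4.fderiv]
  simp [contractedWeight]
  ring

/-- The identity behind Morrey's estimate: the field `(z - x) K_s(z)`, with `K_s` the contracted
weight, has divergence `s ∂_s K_s`, since the contraction only transports mass along rays from `x`.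
Integrating by parts turns the scale derivative of `∫ u K_s` into an integral of `∇u`. -/
theorem sum_fderiv_coord_mul_contractedWeight (hη : ContDiff ℝ ∞ η) (x z : Space d) (s : ℝ) :
    ∑ i, fderiv ℝ (fun z => (z - x) i * contractedWeight η x s z) z (EuclideanSpace.single i 1) =
      s * contractedWeightDeriv η x s z := by
  have h : fderiv ℝ η (x + s • (z - x)) (z - x) = ∑ i, (z - x) i *
      fderiv ℝ η (x + s • (z - x)) (EuclideanSpace.single i 1) := by
    have e : z - x = ∑ i, (z - x) i • EuclideanSpace.single i (1 : ℝ) := by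
      ext j
      simp [Finset.sum_apply, Pi.single_apply]
    conv_lhs => enter [2]; rw [e]
    simp only [map_sum, map_smul, smul_eq_mul]
  simp only [fderiv_coord_mul_contractedWeight hη, Finset.sum_add_distrib,
    contractedWeightDeriv, h]
  rw [Finset.sum_const, Finset.card_univ, Fintype.card_fin, nsmul_eq_mul, mul_add, Finset.mul_sum,
    Finset.mul_sum]
  congr 1
  -- For `d = 0` the exponent `d - 1` is truncated, but it carries the factor `d`.
  · rcases d with _ | n
    · simp
    · simp only [Nat.add_sub_cancel, pow_succ]; ring
  · refine Finset.sum_congr rfl fun i _ => by ring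

theorem sub_eq_of_contractedWeight_ne_zero {c x z : Space d} {r s : ℝ} (hs : 0 < s)
    (hsupp : ∀ y, η y ≠ 0 → y ∈ Metric.closedBall c r) (hz : contractedWeight η x s z ≠ 0) :
    ∃ b ∈ Metric.closedBall c r, z = x + s⁻¹ • (b - x) := by
  refine ⟨x + s • (z - x), hsupp _ fun h => hz (by simp [contractedWeight, h]), ?_⟩
  simp [smul_smul, hs.ne']

/-- For `s ≥ 1` the support lies in the image of the ball under the homothety of ratio `1/s ∈ (0,
1]` centred at `x`. This image is compact, and `hstar` keeps it inside the domain. -/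
theorem isTest_coord_mul_contractedWeight {Ω : TopologicalSpace.Compacts (Space d)}
    (hη : ContDiff ℝ ∞ η) {c x : Space d} {r s : ℝ} (hs : 1 ≤ s)
    (hsupp : ∀ y, η y ≠ 0 → y ∈ Metric.closedBall c r)
    (hstar : ∀ b ∈ Metric.closedBall c r, ∀ t ∈ Ioc (0 : ℝ) 1,
      x + t • (b - x) ∈ interior (Ω : Set (Space d))) (i : Fin d) :
    IsTest Ω (fun z => (z - x) i * contractedWeight η x s z) := by
  have hs0 : 0 < s := by linarith
  set S := (fun b => x + s⁻¹ • (b - x)) '' Metric.closedBall c r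
  have hS : IsCompact S := (isCompact_closedBall c r).image (by fun_prop)
  have hsub : Function.support (fun z => (z - x) i * contractedWeight η x s z) ⊆ S := by
    intro z hz
    obtain ⟨b, hb, e⟩ := sub_eq_of_contractedWeight_ne_zero hs0 hsupp (right_ne_zero_of_mul hz)
    exact ⟨b, hb, e.symm⟩
  have hcl := closure_minimal hsub hS.isClosed
  refine ⟨?_, hS.of_isClosed_subset isClosed_closure hcl, hcl.trans ?_⟩
  · have h1 : ContDiff ℝ ∞ (fun z : Space d => (EuclideanSpace.proj i : Space d →L[ℝ] ℝ) (z - x)) :=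
      (ContinuousLinearMap.contDiff _).comp (contDiff_id.sub contDiff_const)
    have h2 : ContDiff ℝ ∞ (fun z : Space d => η (x + s • (z - x))) :=
      hη.comp (contDiff_const.add ((contDiff_id.sub contDiff_const).const_smul s))
    exact h1.mul (contDiff_const.mul h2)
  · rintro _ ⟨b, hb, rfl⟩
    exact hstar b hb _ ⟨by positivity, inv_le_one_of_one_le₀ hs⟩

theorem integral_mul_contractedWeightDeriv {Ω : TopologicalSpace.Compacts (Space d)} {p : ℝ}
    [Fact (1 ≤ ENNReal.ofReal p)] (u : Sobolev Ω p)
    (hη : ContDiff ℝ ∞ η) {c x : Space d} {r s : ℝ} (hs : 1 ≤ s)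
    (hsupp : ∀ y, η y ≠ 0 → y ∈ Metric.closedBall c r)
    (hstar : ∀ b ∈ Metric.closedBall c r, ∀ t ∈ Ioc (0 : ℝ) 1,
      x + t • (b - x) ∈ interior (Ω : Set (Space d))) :
    s * ∫ z, u.1.1 z * contractedWeightDeriv η x s z ∂(leb Ω) =
      - ∫ z, inner ℝ (u.1.2 z) (z - x) * contractedWeight η x s z ∂(leb Ω) := by
  have ht := fun i => isTest_coord_mul_contractedWeight hη hs hsupp hstar i
  have h := fun i => u.2 _ (ht i) (EuclideanSpace.single i (1 : ℝ))
  have h1 : s * ∫ z, u.1.1 z * contractedWeightDeriv η x s z ∂(leb Ω) =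
      ∑ i, ∫ z, u.1.1 z * fderiv ℝ (fun z => (z - x) i * contractedWeight η x s z) z
        (EuclideanSpace.single i 1) ∂(leb Ω) := by
    rw [← integral_finsetSum, ← integral_const_mul]
    · refine integral_congr_ae (Eventually.of_forall fun z => ?_)
      simp only
      rw [← Finset.mul_sum, sum_fderiv_coord_mul_contractedWeight hη]
      ring
    · exact fun i _ => integrable_mul_of_compact u.1.1 ((ht i).continuous_fderiv _)
        ((ht i).hasCompactSupport_fderiv _)
  rw [h1, Finset.sum_congr rfl fun i _ => h i, Finset.sum_neg_distrib, ← integral_finsetSum]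
  · congr 1
    refine integral_congr_ae (Eventually.of_forall fun z => ?_)
    simp only [← mul_assoc]
    rw [← Finset.sum_mul]
    congr 1
    rw [PiLp.inner_apply]
    refine Finset.sum_congr rfl fun i _ => ?_
    simp [EuclideanSpace.inner_single_right, mul_comm]
  · exact fun i _ => integrable_inner_mul_of_compact u.1.2 _ (ht i).1.continuous (ht i).2.1

/-- Differentiation under the integral: `∂_s K_s(z)` is bounded on the compact set `[s-1, s+1] × Ω`,
so a multiple of `|f|` dominates. -/
theorem hasDerivAt_integral_mul_contractedWeight {Ω : TopologicalSpace.Compacts (Space d)}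
    {f : Space d → ℝ} (hf : Integrable f (leb Ω)) (hη : ContDiff ℝ ∞ η) (x : Space d) (s : ℝ) :
    HasDerivAt (fun s => ∫ z, f z * contractedWeight η x s z ∂(leb Ω))
      (∫ z, f z * contractedWeightDeriv η x s z ∂(leb Ω)) s := by
  have hk : IsCompact (Icc (s - 1) (s + 1) ×ˢ (Ω : Set (Space d))) := isCompact_Icc.prod Ω.isCompact
  obtain ⟨C, hC⟩ := hk.exists_bound_of_continuousOn (continuous_contractedWeightDeriv hη x).continuousOn
  have hΩ : ∀ᵐ z ∂(leb Ω), z ∈ (Ω : Set (Space d)) :=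
    (ae_restrict_mem isOpen_interior.measurableSet).mono fun z hz => interior_subset hz
  obtain ⟨C', hC'⟩ := Ω.isCompact.exists_bound_of_continuousOn
    (continuous_contractedWeight hη x s).continuousOn
  refine (hasDerivAt_integral_of_dominated_loc_of_deriv_le (s := Icc (s - 1) (s + 1))
    (F := fun s z => f z * contractedWeight η x s z)
    (F' := fun s z => f z * contractedWeightDeriv η x s z) (bound := fun z => ‖f z‖ * C)
    (Icc_mem_nhds (by linarith) (by linarith)) ?_ ?_ ?_ ?_ ?_ ?_).2
  · exact Eventually.of_forall fun s =>
      hf.1.mul (continuous_contractedWeight hη x s).aestronglyMeasurable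
  · exact hf.mul_bdd (c := C') (continuous_contractedWeight hη x s).aestronglyMeasurable
      (hΩ.mono hC')
  · exact hf.1.mul ((continuous_contractedWeightDeriv hη x).comp
      (Continuous.prodMk_right s)).aestronglyMeasurable
  · filter_upwards [hΩ] with z hz t ht
    rw [norm_mul]
    exact mul_le_mul_of_nonneg_left (hC (t, z) ⟨ht, hz⟩) (norm_nonneg _)
  · exact hf.norm.mul_const C
  · exact Eventually.of_forall fun z t _ => (hasDerivAt_contractedWeight hη x z t).const_mul (f z)

theorem integral_contractedWeight (x : Space d) {s : ℝ} (hs : 0 < s) :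
    ∫ z, contractedWeight η x s z = ∫ z, η z := by
  unfold contractedWeight
  rw [integral_const_mul]
  have h1 : ∫ z, η (x + s • (z - x)) = ∫ z, η (x + s • z) :=
    integral_sub_right_eq_self (fun z => η (x + s • z)) x
  rw [h1, Measure.integral_comp_smul volume (fun z => η (x + z)) s,
    integral_add_left_eq_self (fun z => η z) x]
  simp only [finrank_euclideanSpace, Fintype.card_fin, smul_eq_mul]
  rw [abs_of_nonneg (by positivity), ← mul_assoc, mul_inv_cancel₀ (by positivity), one_mul]

end Morrey

/-! ### Oscillation bounds for averages, and convergence at Lebesgue points. -/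

section Morrey

open Filter Topology

variable {d : ℕ} {η : Space d → ℝ}

/-- The volume of the unit ball. -/
noncomputable def unitBallVolume (d : ℕ) : ℝ := volume.real (Metric.ball (0 : Space d) 1)

theorem unitBallVolume_pos (d : ℕ) : 0 < unitBallVolume d :=
  ENNReal.toReal_pos (Metric.measure_ball_pos _ _ one_pos).ne' measure_ball_lt_top.ne

theorem volume_real_closedBall (c : Space d) {r : ℝ} (hr : 0 ≤ r) :
    volume.real (Metric.closedBall c r) = r ^ d * unitBallVolume d := by
  rw [Measure.addHaar_real_closedBall _ _ hr]; simp [unitBallVolume]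

theorem setIntegral_norm_le {Ω : TopologicalSpace.Compacts (Space d)} {p q : ℝ}
    (hpq : p.HolderConjugate q) [Fact (1 ≤ ENNReal.ofReal p)] (g : LpVector Ω p)
    (c : Space d) {r : ℝ} (hr : 0 ≤ r) :
    ∫ z in Metric.closedBall c r, ‖g z‖ ∂(leb Ω) ≤ ‖g‖ * (r ^ d * unitBallVolume d) ^ (1 / q) := by
  set B := Metric.closedBall c r
  have hB : MeasurableSet B := measurableSet_closedBall
  have h1 := integral_mul_le_Lp_mul_Lq_of_nonneg (μ := leb Ω) hpq
    (f := fun z => ‖g z‖) (g := B.indicator fun _ => (1 : ℝ))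
    (Eventually.of_forall fun _ => norm_nonneg _)
    (Eventually.of_forall fun z => indicator_nonneg (fun _ _ => zero_le_one) z)
    (Lp.memLp g).norm (memLp_indicator_const _ hB 1 (Or.inr (measure_ne_top _ _)))
  have h2 : ∫ z, ‖g z‖ * B.indicator (fun _ => (1 : ℝ)) z ∂(leb Ω) = ∫ z in B, ‖g z‖ ∂(leb Ω) := by
    rw [← integral_indicator hB]
    refine integral_congr_ae (Eventually.of_forall fun z => ?_)
    by_cases hz : z ∈ B <;> simp [hz]
  have h3 : ∫ z, B.indicator (fun _ => (1 : ℝ)) z ^ q ∂(leb Ω) ≤ r ^ d * unitBallVolume d := by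
    have : ∫ z, B.indicator (fun _ => (1 : ℝ)) z ^ q ∂(leb Ω) = (leb Ω).real B := by
      rw [← integral_indicator_one hB]
      refine integral_congr_ae (Eventually.of_forall fun z => ?_)
      by_cases hz : z ∈ B <;> simp [hz, Real.zero_rpow hpq.symm.ne_zero]
    rw [this, ← volume_real_closedBall c hr]
    exact ENNReal.toReal_mono measure_closedBall_lt_top.ne (Measure.restrict_apply_le _ _)
  have h4 : (∫ z, ‖g z‖ ^ p ∂(leb Ω)) ^ (1 / p) = ‖g‖ := by
    rw [← norm_toLp_rpow hpq.pos (Lp.memLp g), Lp.toLp_coeFn]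
  rw [h2, h4] at h1
  refine h1.trans (mul_le_mul_of_nonneg_left ?_ (norm_nonneg _))
  exact Real.rpow_le_rpow (integral_nonneg fun z => Real.rpow_nonneg
    (indicator_nonneg (fun _ _ => zero_le_one) z) _) h3 (by simpa using hpq.symm.nonneg)

/-- `η` is a smooth weight supported in the ball `closedBall c r` with total mass one and comparable
to the normalized indicator of the ball. -/
structure IsBallWeight (η : Space d → ℝ) (c : Space d) (r : ℝ) : Prop where
  contDiff : ContDiff ℝ ∞ η
  nonneg : ∀ y, 0 ≤ η y
  le : ∀ y, η y ≤ 2 ^ d / (r ^ d * unitBallVolume d)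
  supp : ∀ y, η y ≠ 0 → y ∈ Metric.closedBall c r
  integral : ∫ y, η y = 1

theorem exists_isBallWeight (c : Space d) {r : ℝ} (hr : 0 < r) : ∃ η, IsBallWeight η c r := by
  -- The plateau radius `r/2` is the source of the factor `2^d` in the sup bound.
  let f : ContDiffBump c := ⟨r / 2, r, by positivity, by linarith⟩
  refine ⟨f.normed volume, f.contDiff_normed, f.nonneg_normed, fun y => ?_, fun y hy => ?_,
    f.integral_normed⟩
  · refine (f.normed_le_div_measure_closedBall_rOut volume 2 (by simp [f]; linarith) y).trans ?_
    simp [volume_real_closedBall c hr.le, f]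
  · have : y ∈ Function.support (f.normed volume) := hy
    rw [f.support_normed_eq] at this
    exact Metric.ball_subset_closedBall this

theorem IsBallWeight.contracted_nonneg {c x : Space d} {r s : ℝ} (hη : IsBallWeight η c r)
    (hs : 0 < s) (z : Space d) : 0 ≤ contractedWeight η x s z :=
  mul_nonneg (by positivity) (hη.nonneg _)

theorem IsBallWeight.contracted_le {c x : Space d} {r s : ℝ} (hη : IsBallWeight η c r)
    (hs : 0 < s) (z : Space d) :
    contractedWeight η x s z ≤ s ^ d * (2 ^ d / (r ^ d * unitBallVolume d)) :=
  mul_le_mul_of_nonneg_left (hη.le _) (by positivity)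

theorem IsBallWeight.mem_closedBall {c x z : Space d} {r s : ℝ} (hη : IsBallWeight η c r)
    (hs : 0 < s) (hz : contractedWeight η x s z ≠ 0) :
    z ∈ Metric.closedBall (x + s⁻¹ • (c - x)) (s⁻¹ * r) := by
  obtain ⟨b, hb, rfl⟩ := sub_eq_of_contractedWeight_ne_zero hs hη.supp hz
  rw [mem_closedBall_iff_norm] at hb ⊢
  have : x + s⁻¹ • (b - x) - (x + s⁻¹ • (c - x)) = s⁻¹ • (b - c) := by
    rw [add_sub_add_left_eq_sub, ← smul_sub]; congr 1; abel
  rw [this, norm_smul, Real.norm_of_nonneg (by positivity)]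
  exact mul_le_mul_of_nonneg_left hb (by positivity)

theorem IsBallWeight.norm_sub_le {c x z : Space d} {r s D : ℝ} (hη : IsBallWeight η c r)
    (hs : 0 < s) (hD : ∀ b ∈ Metric.closedBall c r, ‖b - x‖ ≤ D)
    (hz : contractedWeight η x s z ≠ 0) : ‖z - x‖ ≤ s⁻¹ * D := by
  obtain ⟨b, hb, rfl⟩ := sub_eq_of_contractedWeight_ne_zero hs hη.supp hz
  rw [add_sub_cancel_left, norm_smul, Real.norm_of_nonneg (by positivity)]
  exact mul_le_mul_of_nonneg_left (hD b hb) (by positivity)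

/-- The constant in Morrey's estimate. -/
noncomputable def morreyConst (d : ℕ) (p : ℝ) : ℝ := 2 ^ d * (unitBallVolume d) ^ (-(1 / p))

theorem rpow_scaling {p q κ ρ : ℝ} (hpq : p.HolderConjugate q) (hκ : 0 < κ) (hρ : 0 < ρ) :
    (ρ ^ d * κ) ^ (1 / q) / (ρ ^ d * κ) = ρ ^ (-(d / p)) * κ ^ (-(1 / p)) := by
  have h : 1 / q - 1 = -(1 / p) := by
    have := hpq.inv_add_inv_eq_one
    simp only [one_div]; linarith
  have h0 : 0 < ρ ^ d * κ := by positivity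
  nth_rewrite 2 [← Real.rpow_one (ρ ^ d * κ)]
  rw [← Real.rpow_sub h0, h, Real.mul_rpow (by positivity) hκ.le, ← Real.rpow_natCast,
    ← Real.rpow_mul hρ.le]
  congr 2; ring

/-- At scale `ρ = r/s` the weight is at most `2^d / |B_ρ|`, it lives in a ball of radius `ρ`, and
there `|z - x| ≤ Mρ`. Hölder on that ball contributes `|B_ρ|^(1/q)`, and the powers of `ρ` combine
to `ρ^(1 - d/p)`. -/
theorem IsBallWeight.abs_integral_inner_le {Ω : TopologicalSpace.Compacts (Space d)} {p q : ℝ}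
    (hpq : p.HolderConjugate q) [Fact (1 ≤ ENNReal.ofReal p)] (g : LpVector Ω p)
    {c x : Space d} {r s M : ℝ} (hη : IsBallWeight η c r) (hr : 0 < r) (hs : 0 < s) (hM : 0 ≤ M)
    (hD : ∀ b ∈ Metric.closedBall c r, ‖b - x‖ ≤ M * r) :
    |∫ z, inner ℝ (g z) (z - x) * contractedWeight η x s z ∂(leb Ω)| ≤
      M * morreyConst d p * ‖g‖ * (s⁻¹ * r) ^ (1 - d / p) := by
  set ρ := s⁻¹ * r with hρ
  have hρ0 : 0 < ρ := by positivity
  set κ := unitBallVolume d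
  have hκ : 0 < κ := unitBallVolume_pos d
  set B := Metric.closedBall (x + s⁻¹ • (c - x)) ρ
  have hg : Integrable (fun z => ‖g z‖) (leb Ω) := ((Lp.memLp g).integrable Fact.out).norm
  have h1 : ∀ z, ‖inner ℝ (g z) (z - x) * contractedWeight η x s z‖ ≤
      B.indicator (fun z => ‖g z‖ * (M * ρ * (2 ^ d / (ρ ^ d * κ)))) z := by
    intro z
    by_cases hz : contractedWeight η x s z = 0
    · rw [hz, mul_zero, norm_zero]
      exact indicator_nonneg (fun _ _ => by positivity) z
    · rw [indicator_of_mem (hη.mem_closedBall hs hz), norm_mul,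
        Real.norm_of_nonneg (hη.contracted_nonneg hs z)]
      have e1 := norm_inner_le_norm (𝕜 := ℝ) (g z) (z - x)
      have e2 : ‖z - x‖ ≤ M * ρ := (hη.norm_sub_le hs hD hz).trans_eq (by rw [hρ]; ring)
      have e3 : contractedWeight η x s z ≤ 2 ^ d / (ρ ^ d * κ) :=
        (hη.contracted_le hs z).trans_eq (by rw [hρ, mul_pow, inv_pow]; field_simp; exact div_self hκ.ne')
      calc _ ≤ (‖g z‖ * (M * ρ)) * (2 ^ d / (ρ ^ d * κ)) :=
            mul_le_mul (e1.trans (mul_le_mul_of_nonneg_left e2 (norm_nonneg _))) e3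
              (hη.contracted_nonneg hs z) (by positivity)
        _ = _ := by ring
  have h2 := norm_integral_le_of_norm_le ((hg.mul_const _).indicator measurableSet_closedBall)
    (Eventually.of_forall h1)
  rw [integral_indicator measurableSet_closedBall, integral_mul_const] at h2
  refine h2.trans ((mul_le_mul_of_nonneg_right (setIntegral_norm_le hpq g _ hρ0.le)
    (by positivity)).trans_eq ?_)
  have h3 := rpow_scaling (d := d) hpq hκ hρ0
  have h4 : ρ ^ (1 - d / p) = ρ * ρ ^ (-(d / p)) := by
    rw [sub_eq_add_neg, Real.rpow_add hρ0, Real.rpow_one]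
  rw [h4, morreyConst]
  calc _ = M * 2 ^ d * ‖g‖ * ρ * ((ρ ^ d * κ) ^ (1 / q) / (ρ ^ d * κ)) := by ring
    _ = _ := by rw [h3]; ring

/-- With `γ = 1 - d/p`, the scale derivative is at most `A s^(-γ-1)`. Since `p > d` makes `γ`
positive, this has total mass `A/γ` on `[1, ∞)`, so the bound is uniform in `s`. -/
theorem IsBallWeight.abs_integral_sub_le {Ω : TopologicalSpace.Compacts (Space d)} {p q : ℝ}
    (hpq : p.HolderConjugate q) [Fact (1 ≤ ENNReal.ofReal p)] (hpd : d < p) (u : Sobolev Ω p)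
    {c x : Space d} {r s M : ℝ} (hη : IsBallWeight η c r) (hr : 0 < r) (hs : 1 ≤ s) (hM : 0 ≤ M)
    (hD : ∀ b ∈ Metric.closedBall c r, ‖b - x‖ ≤ M * r)
    (hstar : ∀ b ∈ Metric.closedBall c r, ∀ t ∈ Ioc (0 : ℝ) 1,
      x + t • (b - x) ∈ interior (Ω : Set (Space d))) :
    |∫ z, u.1.1 z * contractedWeight η x s z ∂(leb Ω) -
      ∫ z, u.1.1 z * contractedWeight η x 1 z ∂(leb Ω)| ≤
      M * morreyConst d p * ‖u.1.2‖ * r ^ (1 - d / p) / (1 - d / p) := by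
  set γ := 1 - d / p with hγ
  have hγ0 : 0 < γ := by
    have : (d : ℝ) / p < 1 := (div_lt_one hpq.pos).2 hpd
    linarith
  set A := M * morreyConst d p * ‖u.1.2‖ * r ^ γ with hA
  have hA0 : 0 ≤ A := by
    have := (unitBallVolume_pos d).le
    have : 0 ≤ morreyConst d p := by unfold morreyConst; positivity
    positivity
  have hui : Integrable u.1.1 (leb Ω) := (Lp.memLp u.1.1).integrable Fact.out
  set F := fun s => ∫ z, u.1.1 z * contractedWeight η x s z ∂(leb Ω)
  set F' := fun s => ∫ z, u.1.1 z * contractedWeightDeriv η x s z ∂(leb Ω)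
  have hF : ∀ s, HasDerivAt F (F' s) s :=
    fun s => hasDerivAt_integral_mul_contractedWeight hui hη.contDiff x s
  have hB : ∀ t : ℝ, 1 ≤ t → HasDerivAt (fun t => A / γ * (1 - t ^ (-γ))) (A * t ^ (-γ - 1)) t := by
    intro t ht
    have := ((Real.hasDerivAt_rpow_const (x := t) (p := -γ) (Or.inl (by linarith))).const_sub
      1).const_mul (A / γ)
    have e : A / γ * -(-γ * t ^ (-γ - 1)) = A * t ^ (-γ - 1) := by field_simp
    rwa [e] at this
  have hbd : ∀ t : ℝ, 1 ≤ t → ‖F' t‖ ≤ A * t ^ (-γ - 1) := by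
    intro t ht
    have ht0 : 0 < t := by linarith
    have e1 := integral_mul_contractedWeightDeriv u hη.contDiff ht hη.supp hstar
    have e2 := hη.abs_integral_inner_le hpq u.1.2 hr ht0 hM hD
    rw [← abs_neg, ← e1, abs_mul, abs_of_pos ht0] at e2
    rw [Real.norm_eq_abs]
    refine le_of_mul_le_mul_left (e2.trans_eq ?_) ht0
    rw [← hγ, Real.mul_rpow (by positivity) hr.le, Real.inv_rpow ht0.le, ← Real.rpow_neg ht0.le,
      Real.rpow_sub ht0, Real.rpow_one, hA]
    field_simp
  -- Comparison with an explicit majorant instead of the fundamental theorem of calculus, so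
  -- integrability of `F'` is not needed.
  have key := image_norm_le_of_norm_deriv_right_le_deriv_boundary' (a := 1) (b := s)
    (f := fun t => F t - F 1) (f' := F') (B := fun t => A / γ * (1 - t ^ (-γ)))
    (B' := fun t => A * t ^ (-γ - 1))
    (fun t _ => ((hF t).sub_const _).continuousAt.continuousWithinAt)
    (fun t _ => ((hF t).sub_const _).hasDerivWithinAt) (by simp)
    (fun t ht => (hB t ht.1).continuousAt.continuousWithinAt)
    (fun t ht => (hB t ht.1).hasDerivWithinAt) (fun t ht => hbd t ht.1)
    (right_mem_Icc.2 hs)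
  refine key.trans ?_
  have : 0 ≤ s ^ (-γ) := by positivity
  calc A / γ * (1 - s ^ (-γ)) ≤ A / γ * 1 := by gcongr; linarith
    _ = A / γ := mul_one _

/-- `x` is a Lebesgue point of `f`, with respect to all families of balls shrinking to `x`. -/
def IsLebesguePoint (f : Space d → ℝ) (x : Space d) : Prop :=
  ∀ (w : ℝ → Space d) (δ : ℝ → ℝ) (K : ℕ), Tendsto δ atTop (𝓝[>] 0) →
    (∀ᶠ s in atTop, x ∈ Metric.closedBall (w s) (K * δ s)) →
    Tendsto (fun s => ⨍ y in Metric.closedBall (w s) (δ s), ‖f y - f x‖) atTop (𝓝 0)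

theorem ae_isLebesguePoint {f : Space d → ℝ} (hf : LocallyIntegrable f) :
    ∀ᵐ x, IsLebesguePoint f x := by
  have h := fun K : ℕ => IsUnifLocDoublingMeasure.ae_tendsto_average_norm_sub volume hf K
  filter_upwards [ae_all_iff.2 h] with x hx w δ K h1 h2
  exact hx K w δ h1 h2

/-- The contracted weight is at most `2^d` times the normalized indicator of a ball of radius `r/s`.
That ball need not contain `x`, but its enlargement by a fixed factor `K ≥ |c - x|/r` does, which is
why Lebesgue points are taken for off-centre balls. -/
theorem IsBallWeight.tendsto_integral {f : Space d → ℝ} (hf : Integrable f) {c x : Space d} {r : ℝ}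
    (hη : IsBallWeight η c r) (hr : 0 < r) (hx : IsLebesguePoint f x) :
    Tendsto (fun s => ∫ z, f z * contractedWeight η x s z) atTop (𝓝 (f x)) := by
  obtain ⟨K, hK⟩ := exists_nat_ge (‖c - x‖ / r)
  have h0 := hx (fun s => x + s⁻¹ • (c - x)) (fun s => s⁻¹ * r) K ?_ ?_
  · rw [tendsto_iff_norm_sub_tendsto_zero]
    refine squeeze_zero' (Eventually.of_forall fun _ => norm_nonneg _) ?_
      (by simpa only [mul_zero] using h0.const_mul (2 ^ d))
    filter_upwards [eventually_gt_atTop 0] with s hs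
    set ρ := s⁻¹ * r with hρ
    have hρ0 : 0 < ρ := by positivity
    set κ := unitBallVolume d
    have hκ : 0 < κ := unitBallVolume_pos d
    set B := Metric.closedBall (x + s⁻¹ • (c - x)) ρ
    have hbd : ∀ z, contractedWeight η x s z ≤ 2 ^ d / (ρ ^ d * κ) := fun z =>
      (hη.contracted_le hs z).trans_eq (by rw [hρ, mul_pow, inv_pow]; field_simp; exact div_self hκ.ne')
    have hKi : Integrable (contractedWeight η x s) := by
      -- A non-integrable function has Bochner integral `0`, and the integral here is `1`.
      refine Integrable.of_integral_ne_zero ?_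
      rw [integral_contractedWeight x hs, hη.integral]
      exact one_ne_zero
    have hfK : Integrable (fun z => f z * contractedWeight η x s z) :=
      hf.mul_bdd (c := 2 ^ d / (ρ ^ d * κ))
        (continuous_contractedWeight hη.contDiff x s).aestronglyMeasurable
        (Eventually.of_forall fun z => by
          rw [Real.norm_of_nonneg (hη.contracted_nonneg hs z)]; exact hbd z)
    have e1 : (∫ z, f z * contractedWeight η x s z) - f x =
        ∫ z, (f z - f x) * contractedWeight η x s z := by
      simp only [sub_mul]
      rw [integral_sub hfK (hKi.const_mul _), integral_const_mul, integral_contractedWeight x hs,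
        hη.integral, mul_one]
    have hfB : IntegrableOn (fun z => ‖f z - f x‖) B :=
      (hf.integrableOn.sub (integrableOn_const measure_closedBall_lt_top.ne)).norm
    have e2 := norm_integral_le_of_norm_le (f := fun z => (f z - f x) * contractedWeight η x s z)
      (g := B.indicator fun z => ‖f z - f x‖ * (2 ^ d / (ρ ^ d * κ))) (μ := volume)
      ((integrable_indicator_iff measurableSet_closedBall).2 (hfB.mul_const _))
      (Eventually.of_forall fun z => by
        by_cases hz : contractedWeight η x s z = 0
        · rw [hz, mul_zero, norm_zero]
          exact indicator_nonneg (fun _ _ => by positivity) z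
        · rw [indicator_of_mem (hη.mem_closedBall hs hz), norm_mul,
            Real.norm_of_nonneg (hη.contracted_nonneg hs z)]
          exact mul_le_mul_of_nonneg_left (hbd z) (norm_nonneg _))
    rw [integral_indicator measurableSet_closedBall, integral_mul_const] at e2
    rw [e1]
    refine e2.trans_eq ?_
    rw [setAverage_eq, volume_real_closedBall _ hρ0.le, smul_eq_mul]
    change _ = 2 ^ d * ((ρ ^ d * κ)⁻¹ * _)
    rw [div_eq_mul_inv]
    ring
  · rw [tendsto_nhdsWithin_iff]
    refine ⟨by simpa using tendsto_inv_atTop_zero.mul_const r, ?_⟩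
    filter_upwards [eventually_gt_atTop 0] with s hs
    exact mul_pos (inv_pos.2 hs) hr
  · filter_upwards [eventually_gt_atTop 0] with s hs
    rw [mem_closedBall_iff_norm, sub_add_cancel_left, norm_neg, norm_smul,
      Real.norm_of_nonneg (by positivity)]
    have := (div_le_iff₀ hr).1 hK
    calc s⁻¹ * ‖c - x‖ ≤ s⁻¹ * (K * r) := by gcongr
      _ = _ := by ring

end Morrey

/-! ### Geometry of Lipschitz domains, and continuous representatives. -/

section Morrey

open Filter Topology

variable {d : ℕ}

/-- Near the point `x₀`, all points of `U` see, inside `U`, a common ball of comparable size. -/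
def HasCommonBalls (U : Set (Space d)) (x₀ : Space d) : Prop :=
  ∃ M : ℝ, 0 ≤ M ∧ ∃ r₀ : ℝ, 0 < r₀ ∧ ∀ r ∈ Ioo 0 r₀, ∃ c : Space d,
    ∀ x ∈ U ∩ Metric.ball x₀ r, ∀ b ∈ Metric.closedBall c r, ‖b - x‖ ≤ M * r ∧
      ∀ t ∈ Ioc (0 : ℝ) 1, x + t • (b - x) ∈ U

theorem hasCommonBalls_of_mem {U : Set (Space d)} (hU : IsOpen U) {x₀ : Space d} (hx₀ : x₀ ∈ U) :
    HasCommonBalls U x₀ := by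
  obtain ⟨ε, hε, hball⟩ := Metric.isOpen_iff.1 hU x₀ hx₀
  refine ⟨2, by norm_num, ε, hε, fun r hr => ⟨x₀, fun x hx b hb => ⟨?_, fun t ht => ?_⟩⟩⟩
  · have h1 := mem_ball_iff_norm.1 hx.2
    have h2 := mem_closedBall_iff_norm.1 hb
    have : b - x = (b - x₀) - (x - x₀) := by abel
    rw [this]
    exact (norm_sub_le _ _).trans (by linarith)
  · exact hball ((convex_ball x₀ ε).add_smul_sub_mem (Metric.ball_subset_ball hr.2.le hx.2)
      (Metric.closedBall_subset_ball hr.2 hb) ⟨ht.1.le, ht.2⟩)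

theorem norm_dropCoord_sub_le (j : Fin d) (y z : Space d) :
    ‖dropCoord j y - dropCoord j z‖ ≤ ‖y - z‖ := by
  rw [EuclideanSpace.norm_eq, EuclideanSpace.norm_eq]
  refine Real.sqrt_le_sqrt ?_
  have : ∑ i : {i : Fin d // i ≠ j}, ‖(dropCoord j y - dropCoord j z) i‖ ^ 2 =
      ∑ i ∈ Finset.univ.filter (fun i => i ≠ j), ‖(y - z) i‖ ^ 2 := by
    rw [← Finset.sum_subtype_eq_sum_filter, Finset.subtype_univ]
    rfl
  rw [this]
  exact Finset.sum_le_sum_of_subset_of_nonneg (Finset.filter_subset _ _)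
    fun i _ _ => by positivity

theorem dropCoord_add_single (j : Fin d) (y : Space d) (a : ℝ) :
    dropCoord j (y + EuclideanSpace.single j a) = dropCoord j y := by
  ext i
  simp [dropCoord, i.2]

theorem norm_dropCoord_add_smul_sub (j : Fin d) (y v : Space d) (t : ℝ) :
    ‖dropCoord j (y + t • v) - dropCoord j y‖ = |t| * ‖dropCoord j v‖ := by
  have : dropCoord j (y + t • v) - dropCoord j y = t • dropCoord j v := by
    ext i
    simp [dropCoord]
  rw [this, norm_smul, Real.norm_eq_abs]

theorem dropCoord_sub (j : Fin d) (y z : Space d) :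
    dropCoord j (y - z) = dropCoord j y - dropCoord j z := rfl

/-- In graph coordinates take a ball of radius `r` centred at height `L r` below `x₀`. The segment
from `x` to a point of this ball moves sideways by at most `2r` and descends by at least `(L - 2)
r`. If that descent covers the possible change `2Kr` of the graph, the segment stays strictly below
the graph because `x` does. -/
theorem hasCommonBalls_of_mem_frontier {U : Set (Space d)} (hU : HasLipschitzBoundary U)
    {x₀ : Space d} (hx₀ : x₀ ∈ frontier U) : HasCommonBalls U x₀ := by
  obtain ⟨e, j, a, φ, K, hbox, hφ, -, hgraph⟩ := hU x₀ hx₀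
  obtain ⟨m, hm, hmbox⟩ : ∃ m > 0, ∀ z ∈ Metric.ball x₀ m, ∀ i, |e z i| < a i := by
    have h : ∀ᶠ z in 𝓝 x₀, ∀ i, |e z i| < a i := by
      rw [eventually_all]
      intro i
      have hc : Continuous (fun z => |e z i|) :=
        ((EuclideanSpace.proj i : Space d →L[ℝ] ℝ).continuous.comp e.continuous).abs
      exact hc.continuousAt.eventually_lt continuousAt_const (hbox i)
    obtain ⟨m, hm, h⟩ := Metric.eventually_nhds_iff_ball.1 h
    exact ⟨m, hm, h⟩
  -- Chosen so that `L - 2 = 2K`.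
  set L : ℝ := 2 * K + 2 with hL
  have hK0 : (0 : ℝ) ≤ K := K.2
  have hL0 : 0 ≤ L := by positivity
  have hdiff : ∀ y z : Space d, ‖e y - e z‖ = ‖y - z‖ := fun y z => by
    rw [← dist_eq_norm, e.dist_map, dist_eq_norm]
  refine ⟨L + 2, by positivity, m / (L + 2), by positivity, fun r hr =>
    ⟨e.symm (e x₀ + EuclideanSpace.single j (-(L * r))), fun x hx b hb => ?_⟩⟩
  set c := e.symm (e x₀ + EuclideanSpace.single j (-(L * r))) with hc
  have hr0 : 0 < r := hr.1
  have hec : e c = e x₀ + EuclideanSpace.single j (-(L * r)) := e.apply_symm_apply _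
  have hcx : ‖c - x₀‖ = L * r := by
    rw [← hdiff, hec, add_sub_cancel_left, PiLp.norm_single, norm_neg,
      Real.norm_of_nonneg (by positivity)]
  have hxr : ‖x - x₀‖ < r := mem_ball_iff_norm.1 hx.2
  have hbr : ‖b - c‖ ≤ r := mem_closedBall_iff_norm.1 hb
  have hbx₀ : ‖b - x₀‖ ≤ (L + 1) * r := by
    have : b - x₀ = (b - c) + (c - x₀) := by abel
    rw [this]
    exact (norm_add_le _ _).trans (by linarith)
  refine ⟨?_, fun t ht => ?_⟩
  · have : b - x = (b - x₀) - (x - x₀) := by abel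
    rw [this]
    exact (norm_sub_le _ _).trans (by linarith)
  have hrm : (L + 1) * r < m := by
    have := (lt_div_iff₀ (by positivity)).1 hr.2
    nlinarith
  have hxm : x ∈ Metric.ball x₀ m := by
    rw [mem_ball_iff_norm]; nlinarith
  have hbm : b ∈ Metric.ball x₀ m := by
    rw [mem_ball_iff_norm]; linarith
  have hzm : x + t • (b - x) ∈ Metric.ball x₀ m :=
    (convex_ball x₀ m).add_smul_sub_mem hxm hbm ⟨ht.1.le, ht.2⟩
  set z := x + t • (b - x) with hz
  have hez : e z = e x + t • (e b - e x) := by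
    have h1 : e z - e x = e.linearIsometryEquiv (z - x) := (e.map_vsub z x).symm
    have h2 : e b - e x = e.linearIsometryEquiv (b - x) := (e.map_vsub b x).symm
    rw [h2, ← map_smul, ← sub_eq_iff_eq_add', h1, hz, add_sub_cancel_left]
  have hbox' := hmbox z hzm
  have hxU := (hgraph x (hmbox x hxm)).1.1 hx.1
  refine (hgraph z hbox').1.2 ?_
  have hlip : |φ (dropCoord j (e z)) - φ (dropCoord j (e x))| ≤ K * (t * (2 * r)) := by
    have h1 := hφ.dist_le_mul (dropCoord j (e z)) (fun i => hbox' i.1) (dropCoord j (e x))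
      (fun i => hmbox x hxm i.1)
    rw [Real.dist_eq, dist_eq_norm] at h1
    refine h1.trans (mul_le_mul_of_nonneg_left ?_ hK0)
    rw [hez, norm_dropCoord_add_smul_sub, abs_of_pos ht.1, dropCoord_sub]
    refine mul_le_mul_of_nonneg_left ?_ ht.1.le
    have h2 : dropCoord j (e b) - dropCoord j (e x) =
        (dropCoord j (e b) - dropCoord j (e c)) - (dropCoord j (e x) - dropCoord j (e x₀)) := by
      rw [hec, dropCoord_add_single]; abel
    rw [h2]
    refine (norm_sub_le _ _).trans ?_
    have h3 := (norm_dropCoord_sub_le j (e b) (e c)).trans_eq (hdiff b c)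
    have h4 := (norm_dropCoord_sub_le j (e x) (e x₀)).trans_eq (hdiff x x₀)
    linarith
  have hbj : e b j - e x j ≤ -((L - 2) * r) := by
    have h1 : |e b j - e c j| ≤ r := by
      have := PiLp.norm_apply_le (e b - e c) j
      rw [hdiff] at this
      exact this.trans hbr
    have h2 : |e x j - e x₀ j| ≤ r := by
      have := PiLp.norm_apply_le (e x - e x₀) j
      rw [hdiff] at this
      exact this.trans hxr.le
    have h3 : e c j = e x₀ j - L * r := by
      rw [hec]; simp [sub_eq_add_neg]
    have := abs_le.1 h1
    have := abs_le.1 h2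
    linarith
  have hzj : e z j = e x j + t * (e b j - e x j) := by rw [hez]; simp
  have h5 := (abs_le.1 hlip).1
  have h6 := mul_le_mul_of_nonneg_left hbj ht.1.le
  rw [hzj]
  have h7 : K * (t * (2 * r)) = t * ((L - 2) * r) := by rw [hL]; ring
  linarith

theorem hasCommonBalls_of_lipschitz {U : Set (Space d)} (hU : IsBoundedLipschitzDomain U)
    {x₀ : Space d} (hx₀ : x₀ ∈ closure U) : HasCommonBalls U x₀ := by
  by_cases h : x₀ ∈ U
  · exact hasCommonBalls_of_mem hU.1 h
  · refine hasCommonBalls_of_mem_frontier hU.2.2.2 ?_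
    rw [hU.1.frontier_eq]
    exact ⟨hx₀, h⟩

theorem contractedWeight_one (η : Space d → ℝ) (x : Space d) : contractedWeight η x 1 = η := by
  funext z
  simp [contractedWeight]

/-- **Morrey's estimate**: the value of `u` at a Lebesgue point `x` differs little from its average
over a ball that `x` sees inside the domain. -/
theorem IsBallWeight.abs_sub_le {Ω : TopologicalSpace.Compacts (Space d)} {p q : ℝ}
    (hpq : p.HolderConjugate q) [Fact (1 ≤ ENNReal.ofReal p)] (hpd : d < p) (u : Sobolev Ω p)
    {η : Space d → ℝ} {c x : Space d} {r M : ℝ} (hη : IsBallWeight η c r) (hr : 0 < r) (hM : 0 ≤ M)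
    (hD : ∀ b ∈ Metric.closedBall c r, ‖b - x‖ ≤ M * r)
    (hstar : ∀ b ∈ Metric.closedBall c r, ∀ t ∈ Ioc (0 : ℝ) 1,
      x + t • (b - x) ∈ interior (Ω : Set (Space d)))
    (hx : IsLebesguePoint ((interior (Ω : Set (Space d))).indicator u.1.1) x) :
    |(interior (Ω : Set (Space d))).indicator u.1.1 x - ∫ z, u.1.1 z * η z ∂(leb Ω)| ≤
      M * morreyConst d p * ‖u.1.2‖ * r ^ (1 - d / p) / (1 - d / p) := by
  set U := interior (Ω : Set (Space d))
  have hUm : MeasurableSet U := isOpen_interior.measurableSet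
  have hui : Integrable u.1.1 (leb Ω) := (Lp.memLp u.1.1).integrable Fact.out
  have h1 := hη.tendsto_integral ((integrable_indicator_iff hUm).2 hui) hr hx
  have h2 : ∀ s, ∫ z, U.indicator u.1.1 z * contractedWeight η x s z =
      ∫ z, u.1.1 z * contractedWeight η x s z ∂(leb Ω) := fun s => by
    change _ = ∫ z, u.1.1 z * contractedWeight η x s z ∂(volume.restrict U)
    rw [← integral_indicator hUm]
    refine integral_congr_ae (Eventually.of_forall fun z => ?_)
    by_cases hz : z ∈ U <;> simp [hz]
  simp only [h2] at h1
  refine le_of_tendsto ((h1.sub_const _).abs) ?_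
  filter_upwards [eventually_ge_atTop 1] with s hs
  have := hη.abs_integral_sub_le hpq hpd u hr hs hM hD hstar
  rwa [contractedWeight_one] at this

/-- Lebesgue points inside the domain are dense in `Ω`. Along them `u` is Cauchy at every point of
`Ω`, boundary included, so `u` extends continuously from them to `Ω`. -/
theorem exists_isContinuousRep {Ω : TopologicalSpace.Compacts (Space d)} {p q : ℝ}
    (hpq : p.HolderConjugate q) [Fact (1 ≤ ENNReal.ofReal p)] (hpd : d < p)
    (hΩ : IsBoundedLipschitzDomain (interior (Ω : Set (Space d))))
    (hΩ' : closure (interior (Ω : Set (Space d))) = Ω) (u : Sobolev Ω p) :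
    ∃ c : C(Ω, ℝ), IsContinuousRep u.1.1 c := by
  set U := interior (Ω : Set (Space d)) with hU
  have hUo : IsOpen U := isOpen_interior
  set f := U.indicator u.1.1 with hf
  have hui : Integrable u.1.1 (leb Ω) := (Lp.memLp u.1.1).integrable Fact.out
  have hfi : Integrable f := (integrable_indicator_iff hUo.measurableSet).2 hui
  have hae := ae_isLebesguePoint hfi.locallyIntegrable
  set G := U ∩ {x | IsLebesguePoint f x} with hG
  have hGcl : (Ω : Set (Space d)) ⊆ closure G := by
    rw [← hΩ']
    exact closure_minimal ((Measure.dense_of_ae hae).open_subset_closure_inter hUo)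
      isClosed_closure
  have hγ0 : 0 < 1 - d / p := by
    have : (d : ℝ) / p < 1 := (div_lt_one hpq.pos).2 hpd
    linarith
  have hlim : ∀ x₀ ∈ (Ω : Set (Space d)), ∃ y, Tendsto f (𝓝[G] x₀) (𝓝 y) := by
    intro x₀ hx₀
    have : (𝓝[G] x₀).NeBot := mem_closure_iff_nhdsWithin_neBot.1 (hGcl hx₀)
    obtain ⟨M, hM, r₀, hr₀, hball⟩ := hasCommonBalls_of_lipschitz hΩ (x₀ := x₀) (by rwa [hΩ'])
    rw [← cauchy_map_iff_exists_tendsto, Metric.cauchy_iff]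
    refine ⟨inferInstance, fun ε hε => ?_⟩
    have ht : Tendsto (fun r : ℝ => M * morreyConst d p * ‖u.1.2‖ * r ^ (1 - d / p) / (1 - d / p))
        (𝓝[>] 0) (𝓝 0) := by
      have h1 : Tendsto (fun r : ℝ => r ^ (1 - d / p)) (𝓝[>] 0) (𝓝 0) := by
        have := (Real.continuousAt_rpow_const 0 (1 - d / p) (Or.inr hγ0.le)).tendsto
        rw [Real.zero_rpow hγ0.ne'] at this
        exact this.mono_left nhdsWithin_le_nhds
      simpa using (h1.const_mul (M * morreyConst d p * ‖u.1.2‖)).div_const (1 - d / p)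
    obtain ⟨r, hrε, hr⟩ := ((ht.eventually_lt_const (half_pos hε)).and
      (Ioo_mem_nhdsGT hr₀)).exists
    obtain ⟨c, hc⟩ := hball r hr
    obtain ⟨η, hη⟩ := exists_isBallWeight c hr.1
    -- One weight `η` serves all `x` near `x₀`, since its ball is seen from each of them. The
    -- average is thus a common reference value.
    have hkey : ∀ x ∈ G ∩ Metric.ball x₀ r, |f x - ∫ z, u.1.1 z * η z ∂(leb Ω)| < ε / 2 :=
      fun x hx => (hη.abs_sub_le hpq hpd u hr.1 hM (fun b hb => (hc x ⟨hx.1.1, hx.2⟩ b hb).1)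
        (fun b hb => (hc x ⟨hx.1.1, hx.2⟩ b hb).2) hx.1.2).trans_lt hrε
    refine ⟨f '' (G ∩ Metric.ball x₀ r), image_mem_map (Filter.inter_mem self_mem_nhdsWithin
      (mem_nhdsWithin_of_mem_nhds (Metric.ball_mem_nhds _ hr.1))), ?_⟩
    rintro _ ⟨x, hx, rfl⟩ _ ⟨y, hy, rfl⟩
    have h1 := abs_lt.1 (hkey x hx)
    have h2 := abs_lt.1 (hkey y hy)
    rw [Real.dist_eq, abs_lt]
    constructor <;> linarith
  have hcont := continuousOn_extendFrom hGcl hlim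
  refine ⟨⟨(Ω : Set (Space d)).domRestrict (extendFrom G f), hcont.domRestrict⟩, ?_⟩
  refine (ae_restrict_iff' hUo.measurableSet).2 ?_
  filter_upwards [hae] with x hx hxU hxΩ
  have hxG : x ∈ G := ⟨hxU, hx⟩
  obtain ⟨y, hy⟩ := hlim x hxΩ
  -- Since `x` itself belongs to `G`, the limit along `G` at `x` can only be `f x`.
  have h1 : f x = y := pure_le_nhds_iff.1
    ((tendsto_pure_pure f x).mono_right le_rfl |>.mono_right (by
      exact (map_mono (pure_le_nhdsWithin hxG)).trans hy))
  change extendFrom G f x = u.1.1 x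
  rw [extendFrom_eq (hGcl hxΩ) hy, ← h1, hf, indicator_of_mem hxU]

/-- The coincidence set is closed and contains almost all of the interior, which is dense in `Ω`. -/
theorem IsContinuousRep.unique {Ω : TopologicalSpace.Compacts (Space d)}
    (hΩ' : closure (interior (Ω : Set (Space d))) = Ω) {u : Space d → ℝ} {c₁ c₂ : C(Ω, ℝ)}
    (h₁ : IsContinuousRep u c₁) (h₂ : IsContinuousRep u c₂) : c₁ = c₂ := by
  have hUo : IsOpen (interior (Ω : Set (Space d))) := isOpen_interior
  have h : ∀ᵐ x ∂(leb Ω), ∀ hx : x ∈ Ω, c₁ ⟨x, hx⟩ = c₂ ⟨x, hx⟩ := by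
    filter_upwards [h₁, h₂] with x h1 h2 hx
    rw [h1 hx, h2 hx]
  rw [leb, ae_restrict_iff' hUo.measurableSet] at h
  have hd := (Measure.dense_of_ae h).open_subset_closure_inter hUo
  have hcl : IsClosed (Subtype.val '' {x : Ω | c₁ x = c₂ x}) :=
    Ω.isCompact.isClosed.isClosedEmbedding_subtypeVal.isClosedMap _
      (isClosed_eq c₁.continuous c₂.continuous)
  have hsub : interior (Ω : Set (Space d)) ∩ {x | x ∈ interior (Ω : Set (Space d)) →
      ∀ hx : x ∈ Ω, c₁ ⟨x, hx⟩ = c₂ ⟨x, hx⟩} ⊆ Subtype.val '' {x : Ω | c₁ x = c₂ x} :=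
    fun x hx => ⟨⟨x, interior_subset hx.1⟩, hx.2 hx.1 _, rfl⟩
  have hΩsub : (Ω : Set (Space d)) ⊆ Subtype.val '' {x : Ω | c₁ x = c₂ x} := by
    rw [← hΩ']
    exact closure_minimal (hd.trans (closure_minimal hsub hcl)) hcl
  ext ⟨x, hx⟩
  obtain ⟨y, hy, e⟩ := hΩsub hx
  have : y = ⟨x, hx⟩ := Subtype.ext e
  exact this ▸ hy

end Morrey

/-! ### The conjugate of the integrand -/

section Integrand

open Filter Topology

variable {d : ℕ} {ε δ α α' : ℝ} {w : Space d → ℝ}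

/-- The explicit conjugate of `𝓖`, as a function of the value `W` of the weight and of `r = ‖q‖`. -/
noncomputable def conjFormula (ε δ α W r : ℝ) : ℝ :=
  ε / α * (max (r - δ) 0) ^ α + W * ((min r δ) ^ 2 / (2 * δ) - δ + max (r - δ) 0)

/-- The gradient of the conjugate of `𝓖` in its second variable. -/
noncomputable def conjGrad (ε δ α : ℝ) (w : Space d → ℝ) (x q : Space d) : Space d :=
  ((ε * (max (‖q‖ - δ) 0) ^ (α - 1) + w x) / max ‖q‖ δ) • q

theorem conjFormula_eq_ite (hα : 0 < α) (W r : ℝ) :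
    conjFormula ε δ α W r = if r ≤ δ then r ^ 2 * (W / (2 * δ)) - δ * W
      else ε / α * (r - δ) ^ α - 3 / 2 * δ * W + r * W := by
  unfold conjFormula
  split_ifs with h
  · rw [max_eq_right (by linarith), min_eq_left h, Real.zero_rpow hα.ne']
    ring
  · rw [max_eq_left (by linarith), min_eq_right (by linarith)]
    field_simp
    ring

theorem calG_of_norm_le (hα' : 0 < α') {x p : Space d} (hw : 0 ≤ w x) (h : ‖p‖ ≤ w x) :
    calG ε δ α' w x p = δ * w x + δ / 2 * (‖p‖ ^ 2 / w x) := by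
  have h1 : ‖p‖ ^ 2 / w x ≤ w x := by
    rcases hw.eq_or_lt with h0 | h0
    · rw [← h0]; simp
    · rw [div_le_iff₀ h0]
      nlinarith [norm_nonneg p]
  rw [calG, calF, calR, max_eq_right (by linarith), mul_zero, Real.zero_rpow hα'.ne',
    max_eq_right h, min_eq_left h1]
  ring

theorem calG_of_lt_norm {x p : Space d} (hw : 0 ≤ w x) (h : w x < ‖p‖) :
    calG ε δ α' w x p =
      ε / α' * ((‖p‖ - w x) / ε) ^ α' + δ * ‖p‖ + δ / 2 * w x := by
  have h1 : min (‖p‖ ^ 2 / w x) (w x) = w x := by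
    rcases hw.eq_or_lt with h0 | h0
    · rw [← h0]; simp
    · rw [min_eq_right]
      rw [le_div_iff₀ h0]
      nlinarith
  rw [calG, calF, calR, max_eq_left (by linarith), max_eq_left h.le, h1, one_div_mul_eq_div]
  ring

/-- The **Fenchel–Young inequality** for `𝓖`. -/
theorem inner_sub_calG_le (hα : α.HolderConjugate α') (hε : 0 < ε) (hδ : 0 < δ) {x : Space d}
    (hw : 0 ≤ w x) (p q : Space d) :
    inner ℝ q p - calG ε δ α' w x p ≤ conjFormula ε δ α (w x) ‖q‖ := by
  have hin := real_inner_le_norm q p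
  rw [conjFormula_eq_ite hα.pos]
  set W := w x
  set r := ‖q‖
  set s := ‖p‖ with hs
  have hr0 : 0 ≤ r := norm_nonneg q
  have hs0 : 0 ≤ s := norm_nonneg p
  have hα0 := hα.pos
  have hα'0 := hα.symm.pos
  rcases le_or_gt s W with h | h
  · rw [calG_of_norm_le hα'0 hw h, ← hs]
    change _ - (δ * W + δ / 2 * (s ^ 2 / W)) ≤ _
    -- If `W = 0` then `s = 0`, and the quotient `s²/W` is `0` by convention.
    rcases hw.eq_or_lt with h0 | h0
    · have hs' : s = 0 := le_antisymm (h.trans_eq h0.symm) hs0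
      have hW : W = 0 := h0.symm
      rw [hs', mul_zero] at hin
      rw [hW]
      split_ifs with hr
      · simpa using hin
      · have : 0 ≤ ε / α * (r - δ) ^ α :=
          mul_nonneg (by positivity) (Real.rpow_nonneg (by linarith) _)
        simpa using hin.trans this
    · have hW : 0 < W := h0
      split_ifs with hr
      · have : r * s ≤ r ^ 2 * (W / (2 * δ)) + δ / 2 * (s ^ 2 / W) := by
          rw [← sub_nonneg]
          have e : r ^ 2 * (W / (2 * δ)) + δ / 2 * (s ^ 2 / W) - r * s =
              (r * W - δ * s) ^ 2 / (2 * δ * W) := by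
            field_simp; ring
          rw [e]; positivity
        linarith
      · push Not at hr
        have h1 : 0 ≤ ε / α * (r - δ) ^ α :=
          mul_nonneg (by positivity) (Real.rpow_nonneg (by linarith) _)
        have h2 : δ * (W - s) ≤ r * (W - s) := by
          apply mul_le_mul_of_nonneg_right hr.le; linarith
        have h3 : δ / 2 * (W - s ^ 2 / W) ≤ δ * (W - s) := by
          rw [← sub_nonneg]
          have e : δ * (W - s) - δ / 2 * (W - s ^ 2 / W) = δ * (W - s) ^ 2 / (2 * W) := by
            field_simp; ring
          rw [e]; positivity
        linarith
  · rw [calG_of_lt_norm hw h, ← hs]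
    change _ - (ε / α' * ((s - W) / ε) ^ α' + δ * s + δ / 2 * W) ≤ _
    have hW0 : 0 ≤ W := hw
    have hsW : 0 ≤ (s - W) / ε := div_nonneg (by linarith) hε.le
    split_ifs with hr
    · have h1 : 0 ≤ ε / α' * ((s - W) / ε) ^ α' := by positivity
      have h2 : (δ - r) * W ≤ (δ - r) * s := mul_le_mul_of_nonneg_left h.le (by linarith)
      have h3 : 0 ≤ W * ((r - δ) ^ 2 / (2 * δ)) := by positivity
      have e : W * ((r - δ) ^ 2 / (2 * δ)) =
          r ^ 2 * (W / (2 * δ)) - r * W + δ / 2 * W := by field_simp; ring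
      linarith
    -- The only case involving the exponents: Young's inequality for `r - δ` and `(s - W)/ε`, scaled
    -- by `ε`. The three other cases reduce to products and squares with a sign.
    · push Not at hr
      have h1 := Real.young_inequality_of_nonneg (sub_nonneg.2 hr.le) hsW hα
      have h2 := mul_le_mul_of_nonneg_left h1 hε.le
      have e1 : ε * ((r - δ) * ((s - W) / ε)) = (r - δ) * (s - W) := by field_simp
      have e2 : ε * ((r - δ) ^ α / α + ((s - W) / ε) ^ α' / α') =
          ε / α * (r - δ) ^ α + ε / α' * ((s - W) / ε) ^ α' := by ring
      rw [e1, e2] at h2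
      linarith

/-- Equality holds in the Fenchel–Young inequality at `p = conjGrad q`. -/
theorem inner_conjGrad_sub_calG (hα : α.HolderConjugate α') (hε : 0 < ε) (hδ : 0 < δ)
    {x : Space d} (hw : 0 ≤ w x) (q : Space d) :
    inner ℝ q (conjGrad ε δ α w x q) - calG ε δ α' w x (conjGrad ε δ α w x q) =
      conjFormula ε δ α (w x) ‖q‖ := by
  have hα1 : 0 < α - 1 := by linarith [hα.lt]
  have hα'0 := hα.symm.pos
  rw [conjFormula_eq_ite hα.pos]
  have hin : inner ℝ q (conjGrad ε δ α w x q) =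
      (ε * (max (‖q‖ - δ) 0) ^ (α - 1) + w x) / max ‖q‖ δ * ‖q‖ ^ 2 := by
    rw [conjGrad, real_inner_smul_right, real_inner_self_eq_norm_sq]
  have hn : ‖conjGrad ε δ α w x q‖ =
      (ε * (max (‖q‖ - δ) 0) ^ (α - 1) + w x) / max ‖q‖ δ * ‖q‖ := by
    rw [conjGrad, norm_smul, Real.norm_of_nonneg]
    have := lt_max_of_lt_right (b := ‖q‖) hδ
    have : (0 : ℝ) ≤ max (‖q‖ - δ) 0 := le_max_right _ _
    positivity
  have hr0 := norm_nonneg q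
  split_ifs with hr
  · rw [max_eq_right (by linarith), Real.zero_rpow hα1.ne', max_eq_right hr, mul_zero,
      zero_add] at hin hn
    have hle : ‖conjGrad ε δ α w x q‖ ≤ w x := by
      rw [hn, div_mul_eq_mul_div, div_le_iff₀ hδ]
      exact mul_le_mul_of_nonneg_left hr hw
    rw [calG_of_norm_le hα'0 hw hle, hin, hn]
    rcases hw.eq_or_lt with h0 | h0
    · rw [← h0]; simp
    · field_simp; ring
  · push Not at hr
    have hr0 : 0 < ‖q‖ := hδ.trans hr
    rw [max_eq_left (by linarith), max_eq_left hr.le] at hin hn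
    rw [div_mul_cancel₀ _ hr0.ne'] at hn
    have hpos : 0 < (‖q‖ - δ) ^ (α - 1) := Real.rpow_pos_of_pos (by linarith) _
    have hlt : w x < ‖conjGrad ε δ α w x q‖ := by
      rw [hn]; linarith [mul_pos hε hpos]
    have e1 : (‖conjGrad ε δ α w x q‖ - w x) / ε = (‖q‖ - δ) ^ (α - 1) := by
      rw [hn]; field_simp; ring
    have e2 : ((‖q‖ - δ) ^ (α - 1)) ^ α' = (‖q‖ - δ) ^ α := by
      rw [← Real.rpow_mul (by linarith), hα.sub_one_mul_conj]
    have e3 : (‖q‖ - δ) ^ α = (‖q‖ - δ) * (‖q‖ - δ) ^ (α - 1) := by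
      rw [mul_comm, ← Real.rpow_add_one (by linarith)]
      congr 1; ring
    have e4 : α'⁻¹ = 1 - α⁻¹ := by have := hα.inv_add_inv_eq_one; linarith
    rw [calG_of_lt_norm hw hlt, e1, e2, hin, hn, div_eq_mul_inv ε α', e4, e3]
    field_simp
    ring

theorem calGConj_eq (hα : α.HolderConjugate α') (hε : 0 < ε) (hδ : 0 < δ) {x : Space d}
    (hw : 0 ≤ w x) (q : Space d) :
    calGConj ε δ α' w x q = ((conjFormula ε δ α (w x) ‖q‖ : ℝ) : EReal) := by
  refine le_antisymm (iSup_le fun p => EReal.coe_le_coe_iff.2 (inner_sub_calG_le hα hε hδ hw p q))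
    ?_
  rw [← inner_conjGrad_sub_calG hα hε hδ hw q]
  exact le_iSup (fun p : Space d => ((inner ℝ q p - calG ε δ α' w x p : ℝ) : EReal)) _

theorem norm_conjGrad_le (hα : 1 < α) (hε : 0 < ε) (hδ : 0 < δ) {x : Space d} (hw : 0 ≤ w x)
    (q : Space d) : ‖conjGrad ε δ α w x q‖ ≤ ε * ‖q‖ ^ (α - 1) + w x := by
  have hm : 0 < max ‖q‖ δ := lt_max_of_lt_right hδ
  have h0 : (0 : ℝ) ≤ max (‖q‖ - δ) 0 := le_max_right _ _
  have h1 : max (‖q‖ - δ) 0 ≤ ‖q‖ := max_le (by linarith) (norm_nonneg _)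
  have h2 : (max (‖q‖ - δ) 0) ^ (α - 1) ≤ ‖q‖ ^ (α - 1) :=
    Real.rpow_le_rpow h0 h1 (by linarith)
  rw [conjGrad, norm_smul, Real.norm_of_nonneg (by positivity), div_mul_eq_mul_div,
    div_le_iff₀ hm]
  gcongr
  exact le_max_left _ _

theorem continuous_conjGrad (hα : 1 < α) (hδ : 0 < δ) (x : Space d) :
    Continuous (conjGrad ε δ α w x) := by
  unfold conjGrad
  refine Continuous.smul (Continuous.div ?_ (by fun_prop) fun q =>
    (lt_max_of_lt_right hδ).ne') continuous_id
  refine Continuous.add (Continuous.mul continuous_const ?_) continuous_const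
  exact Continuous.rpow_const (by fun_prop) fun _ => Or.inr (by linarith)

theorem calG_nonneg (hε : 0 < ε) (hδ : 0 < δ) (hα' : 0 < α') {x : Space d} (hw : 0 ≤ w x)
    (p : Space d) : 0 ≤ calG ε δ α' w x p := by
  unfold calG calF calR
  have h1 : 0 ≤ min (‖p‖ ^ 2 / w x) (w x) := le_min (by positivity) hw
  have h2 : 0 ≤ max ‖p‖ (w x) := le_max_of_le_right hw
  have h3 : (0 : ℝ) ≤ max (‖p‖ - w x) 0 := le_max_right _ _
  positivity

theorem calG_le (hε : 0 < ε) (hδ : 0 < δ) (hα' : 0 < α') {x : Space d} (hw : 0 ≤ w x)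
    (p : Space d) : calG ε δ α' w x p ≤
      ε / α' * (1 / ε) ^ α' * ‖p‖ ^ α' + (δ * ‖p‖ + 2 * δ * w x) := by
  unfold calG calF calR
  have h0 := norm_nonneg p
  have h1 : min (‖p‖ ^ 2 / w x) (w x) ≤ w x := min_le_right _ _
  have h2 : max ‖p‖ (w x) ≤ ‖p‖ + w x := max_le (by linarith) (by linarith)
  have h3 : (0 : ℝ) ≤ max (‖p‖ - w x) 0 := le_max_right _ _
  have h4 : max (‖p‖ - w x) 0 ≤ ‖p‖ := max_le (by linarith) h0
  rw [Real.mul_rpow (by positivity) h3, ← mul_assoc]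
  have h5 : (max (‖p‖ - w x) 0) ^ α' ≤ ‖p‖ ^ α' := Real.rpow_le_rpow h3 h4 hα'.le
  have h6 := mul_le_mul_of_nonneg_left h5
    (by positivity : 0 ≤ ε / α' * (1 / ε) ^ α')
  have h7 := mul_le_mul_of_nonneg_left h2 hδ.le
  have h8 := mul_le_mul_of_nonneg_left h1 (half_pos hδ).le
  nlinarith

theorem abs_conjFormula_le (hα : 0 < α) (hε : 0 < ε) (hδ : 0 < δ) {W r : ℝ} (hW : 0 ≤ W)
    (hr : 0 ≤ r) : |conjFormula ε δ α W r| ≤ ε / α * r ^ α + W * (δ + r) := by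
  have h0 : (0 : ℝ) ≤ max (r - δ) 0 := le_max_right _ _
  have h1 : max (r - δ) 0 ≤ r := max_le (by linarith) hr
  have h2 : (max (r - δ) 0) ^ α ≤ r ^ α := Real.rpow_le_rpow h0 h1 hα.le
  have h3 : 0 ≤ min r δ := le_min hr hδ.le
  have h4 : (min r δ) ^ 2 / (2 * δ) ≤ δ := by
    rw [div_le_iff₀ (by positivity)]
    nlinarith [min_le_right r δ]
  have h5 : 0 ≤ (min r δ) ^ 2 / (2 * δ) := by positivity
  unfold conjFormula
  refine (abs_add_le _ _).trans (add_le_add ?_ ?_)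
  · rw [abs_of_nonneg (by positivity)]
    gcongr
  · rw [abs_mul, abs_of_nonneg hW]
    refine mul_le_mul_of_nonneg_left ?_ hW
    rw [abs_le]
    constructor <;> linarith

theorem add_rpow_le_two_rpow_mul {a b p : ℝ} (ha : 0 ≤ a) (hb : 0 ≤ b) (hp : 1 ≤ p) :
    (a + b) ^ p ≤ 2 ^ (p - 1) * (a ^ p + b ^ p) := by
  lift a to ℝ≥0 using ha
  lift b to ℝ≥0 using hb
  exact_mod_cast NNReal.rpow_add_le_mul_rpow_add_rpow a b hp

/-- Coercivity of `𝓖*`: only the term `(r - δ)₊^α` is kept, and convexity of the power absorbs the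
shift by `δ`. -/
theorem rpow_le_conjFormula (hα : 1 < α) (hε : 0 < ε) (hδ : 0 < δ) {W r : ℝ} (hW : 0 ≤ W)
    (hr : 0 ≤ r) :
    r ^ α ≤ 2 ^ (α - 1) * (α / ε * (conjFormula ε δ α W r + δ * W) + δ ^ α) := by
  have h0 : (0 : ℝ) ≤ max (r - δ) 0 := le_max_right _ _
  have h1 : r ≤ max (r - δ) 0 + δ := by linarith [le_max_left (r - δ) 0]
  have h2 : r ^ α ≤ (max (r - δ) 0 + δ) ^ α := Real.rpow_le_rpow hr h1 (by linarith)
  have h3 := add_rpow_le_two_rpow_mul h0 hδ.le hα.le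
  refine h2.trans (h3.trans (mul_le_mul_of_nonneg_left ?_ (by positivity)))
  have h4 : 0 ≤ W * ((min r δ) ^ 2 / (2 * δ) + max (r - δ) 0) := by positivity
  have h5 : ε / α * (max (r - δ) 0) ^ α ≤ conjFormula ε δ α W r + δ * W := by
    unfold conjFormula; linarith
  have h6 := mul_le_mul_of_nonneg_left h5 (by positivity : 0 ≤ α / ε)
  have e : α / ε * (ε / α * (max (r - δ) 0) ^ α) = (max (r - δ) 0) ^ α := by
    have : α ≠ 0 := by linarith
    field_simp
  linarith

end Integrand

/-! ### Integral functionals -/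

section IntegralFunctionals

open Filter Topology

variable {d : ℕ} {Ω : TopologicalSpace.Compacts (Space d)} {ε δ α α' : ℝ} {w : Space d → ℝ}

theorem ae_leb_mem (Ω : TopologicalSpace.Compacts (Space d)) : ∀ᵐ x ∂(leb Ω), x ∈ Ω :=
  (ae_restrict_mem isOpen_interior.measurableSet).mono fun _ hx => interior_subset hx

theorem memLp_of_continuousOn (hw : ContinuousOn w Ω) (P : ℝ≥0∞) : MemLp w P (leb Ω) := by
  obtain ⟨C, hC⟩ := Ω.isCompact.exists_bound_of_continuousOn hw
  exact MemLp.of_bound ((hw.mono interior_subset).aestronglyMeasurable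
    isOpen_interior.measurableSet) C ((ae_leb_mem Ω).mono hC)

theorem integrable_norm_rpow (hα : 0 < α) (q : LpVector Ω α) :
    Integrable (fun x => ‖q x‖ ^ α) (leb Ω) := by
  have := (integrable_norm_rpow_iff (Lp.memLp q).1 (by simpa using hα) (by simp)).2 (Lp.memLp q)
  rwa [ENNReal.toReal_ofReal hα.le] at this

theorem integrable_inner (hα : α.HolderConjugate α') {f g : Space d → Space d}
    (hf : MemLp f (ENNReal.ofReal α) (leb Ω)) (hg : MemLp g (ENNReal.ofReal α') (leb Ω)) :
    Integrable (fun x => inner ℝ (f x) (g x)) (leb Ω) := by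
  have : (ENNReal.ofReal α).HolderConjugate (ENNReal.ofReal α') := hα.ennrealOfReal
  exact memLp_one_iff_integrable.1 ((innerSL ℝ).memLp_of_bilin 1 hf hg)

/-- The pairing `(q, ξ) ↦ ∫ q · ξ` of `L^α` and `L^α'`. -/
noncomputable def dualPairing [Fact (1 ≤ ENNReal.ofReal α)] [Fact (1 ≤ ENNReal.ofReal α')]
    (Ω : TopologicalSpace.Compacts (Space d)) (hα : α.HolderConjugate α') :
    LpVector Ω α →L[ℝ] StrongDual ℝ (LpVector Ω α') :=
  haveI : (ENNReal.ofReal α).HolderConjugate (ENNReal.ofReal α') := hα.ennrealOfReal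
  (innerSL ℝ).lpPairing (leb Ω) (ENNReal.ofReal α) (ENNReal.ofReal α')

theorem dualPairing_apply [Fact (1 ≤ ENNReal.ofReal α)] [Fact (1 ≤ ENNReal.ofReal α')]
    (hα : α.HolderConjugate α') (q : LpVector Ω α) (ξ : LpVector Ω α') :
    dualPairing Ω hα q ξ = ∫ x, inner ℝ (q x) (ξ x) ∂(leb Ω) := by
  have : (ENNReal.ofReal α).HolderConjugate (ENNReal.ofReal α') := hα.ennrealOfReal
  exact ContinuousLinearMap.lpPairing_eq_integral _ _ _

theorem integrable_calG (hα : α.HolderConjugate α') (hε : 0 < ε) (hδ : 0 < δ)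
    [Fact (1 ≤ ENNReal.ofReal α')] (hw : ContinuousOn w Ω) (hw0 : ∀ x ∈ Ω, 0 ≤ w x)
    (ξ : LpVector Ω α') : Integrable (fun x => calG ε δ α' w x (ξ x)) (leb Ω) := by
  have hwi : Integrable w (leb Ω) := memLp_one_iff_integrable.1 (memLp_of_continuousOn hw 1)
  have hξi : Integrable ξ (leb Ω) := (Lp.memLp ξ).integrable Fact.out
  have hwm := hwi.aemeasurable
  have hξm := hξi.norm.aemeasurable
  have hm : AEMeasurable (fun x => calG ε δ α' w x (ξ x)) (leb Ω) := by
    unfold calG calF calR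
    fun_prop
  refine (((integrable_norm_rpow hα.symm.pos ξ).const_mul (ε / α' * (1 / ε) ^ α')).add
    ((hξi.norm.const_mul δ).add (hwi.const_mul (2 * δ)))).mono' hm.aestronglyMeasurable ?_
  filter_upwards [ae_leb_mem Ω] with x hx
  rw [Real.norm_of_nonneg (calG_nonneg hε hδ hα.symm.pos (hw0 x hx) _)]
  exact calG_le hε hδ hα.symm.pos (hw0 x hx) _

theorem integrable_conjFormula (hα : α.HolderConjugate α') (hε : 0 < ε) (hδ : 0 < δ)
    [Fact (1 ≤ ENNReal.ofReal α)] (hw : ContinuousOn w Ω) (hw0 : ∀ x ∈ Ω, 0 ≤ w x)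
    (q : LpVector Ω α) : Integrable (fun x => conjFormula ε δ α (w x) ‖q x‖) (leb Ω) := by
  have hwi : Integrable w (leb Ω) := memLp_one_iff_integrable.1 (memLp_of_continuousOn hw 1)
  have hqi : Integrable q (leb Ω) := (Lp.memLp q).integrable Fact.out
  have hwm := hwi.aemeasurable
  have hqm := hqi.norm.aemeasurable
  have hm : AEMeasurable (fun x => conjFormula ε δ α (w x) ‖q x‖) (leb Ω) := by
    unfold conjFormula
    fun_prop
  obtain ⟨C, hC⟩ := Ω.isCompact.exists_bound_of_continuousOn hw
  refine (((integrable_norm_rpow hα.pos q).const_mul (ε / α)).add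
    (((integrable_const δ).add hqi.norm).const_mul C)).mono' hm.aestronglyMeasurable ?_
  filter_upwards [ae_leb_mem Ω] with x hx
  refine (abs_conjFormula_le hα.pos hε hδ (hw0 x hx) (norm_nonneg _)).trans ?_
  have : w x ≤ C := (le_abs_self _).trans (hC x hx)
  simp only [Pi.add_apply]
  gcongr

theorem toReal_calGConj_ae_eq (hα : α.HolderConjugate α') (hε : 0 < ε) (hδ : 0 < δ)
    (hw0 : ∀ x ∈ Ω, 0 ≤ w x) (q : Space d → Space d) :
    (fun x => (calGConj ε δ α' w x (q x)).toReal) =ᵐ[leb Ω]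
      fun x => conjFormula ε δ α (w x) ‖q x‖ := by
  filter_upwards [ae_leb_mem Ω] with x hx
  rw [calGConj_eq hα hε hδ (hw0 x hx), EReal.toReal_coe]

theorem intGConj_eq (hα : α.HolderConjugate α') (hε : 0 < ε) (hδ : 0 < δ)
    (hw0 : ∀ x ∈ Ω, 0 ≤ w x) (q : LpVector Ω α) :
    intGConj Ω ε δ α α' w q = ∫ x, conjFormula ε δ α (w x) ‖q x‖ ∂(leb Ω) :=
  integral_congr_ae (toReal_calGConj_ae_eq hα hε hδ hw0 q)

/-- `(α - 1) α' = α`. Together with `norm_conjGrad_le`, this places `conjGrad` in the dual space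
`L^α'`. -/
theorem memLp_norm_rpow_sub_one (hα : α.HolderConjugate α') {E : Type*} [NormedAddCommGroup E]
    {f : Space d → E} (hf : MemLp f (ENNReal.ofReal α) (leb Ω)) :
    MemLp (fun x => ‖f x‖ ^ (α - 1)) (ENNReal.ofReal α') (leb Ω) := by
  have h := hf.norm_rpow_div (ENNReal.ofReal (α - 1))
  rwa [ENNReal.toReal_ofReal hα.sub_one_pos.le, ← ENNReal.ofReal_div_of_pos hα.sub_one_pos,
    ← hα.conjugate_eq] at h

theorem aestronglyMeasurable_conjGrad (hw : ContinuousOn w Ω)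
    {f : Space d → Space d} (hf : AEStronglyMeasurable f (leb Ω)) :
    AEStronglyMeasurable (fun x => conjGrad ε δ α w x (f x)) (leb Ω) := by
  have hwm := (memLp_of_continuousOn hw 1).1.aemeasurable
  have hfm := hf.norm.aemeasurable
  have h : AEMeasurable (fun x => (ε * (max (‖f x‖ - δ) 0) ^ (α - 1) + w x) / max ‖f x‖ δ)
      (leb Ω) := by fun_prop
  exact h.aestronglyMeasurable.smul hf

theorem memLp_conjGrad (hα : α.HolderConjugate α') (hε : 0 < ε) (hδ : 0 < δ)
    (hw : ContinuousOn w Ω) (hw0 : ∀ x ∈ Ω, 0 ≤ w x) (q : LpVector Ω α) :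
    MemLp (fun x => conjGrad ε δ α w x (q x)) (ENNReal.ofReal α') (leb Ω) := by
  refine (((memLp_norm_rpow_sub_one hα (Lp.memLp q)).const_mul ε).add
    (memLp_of_continuousOn hw _)).mono (aestronglyMeasurable_conjGrad hw (Lp.memLp q).1) ?_
  filter_upwards [ae_leb_mem Ω] with x hx
  exact (norm_conjGrad_le hα.lt hε hδ (hw0 x hx) _).trans (le_abs_self _)

variable [Fact (1 ≤ ENNReal.ofReal α)]

theorem exists_norm_le_of_intGConj_le (hα : α.HolderConjugate α') (hε : 0 < ε) (hδ : 0 < δ)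
    (hw : ContinuousOn w Ω) (hw0 : ∀ x ∈ Ω, 0 ≤ w x) (c : ℝ) :
    ∃ R : ℝ, ∀ q : LpVector Ω α, intGConj Ω ε δ α α' w q ≤ c → ‖q‖ ≤ R := by
  have hwi : Integrable w (leb Ω) := memLp_one_iff_integrable.1 (memLp_of_continuousOn hw 1)
  refine ⟨(2 ^ (α - 1) * (α / ε * (c + δ * ∫ x, w x ∂(leb Ω)) +
    δ ^ α * (leb Ω).real univ)) ^ (1 / α), fun q hq => ?_⟩
  have hα0 := hα.pos
  have e : ‖q‖ = (∫ x, ‖q x‖ ^ α ∂(leb Ω)) ^ (1 / α) := by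
    rw [← norm_toLp_rpow hα.pos (Lp.memLp q), Lp.toLp_coeFn]
  rw [e]
  refine Real.rpow_le_rpow (integral_nonneg fun x => by positivity) ?_ (by positivity)
  have hi := integrable_conjFormula hα hε hδ hw hw0 q
  have h1 : Integrable (fun x => 2 ^ (α - 1) *
      (α / ε * (conjFormula ε δ α (w x) ‖q x‖ + δ * w x) + δ ^ α)) (leb Ω) :=
    (((hi.add (hwi.const_mul δ)).const_mul _).add (integrable_const _)).const_mul _
  have h2 := integral_mono_ae (integrable_norm_rpow hα.pos q) h1 (by
    filter_upwards [ae_leb_mem Ω] with x hx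
    exact rpow_le_conjFormula hα.lt hε hδ (hw0 x hx) (norm_nonneg _))
  refine h2.trans ?_
  have hA : Integrable (fun x => conjFormula ε δ α (w x) ‖q x‖ + δ * w x) (leb Ω) :=
    hi.add (hwi.const_mul δ)
  rw [integral_const_mul, integral_add (hA.const_mul _) (integrable_const _), integral_const_mul,
    integral_add hi (hwi.const_mul δ), integral_const_mul, integral_const,
    ← intGConj_eq hα hε hδ hw0, smul_eq_mul, mul_comm ((leb Ω).real univ)]
  gcongr

variable [Fact (1 ≤ ENNReal.ofReal α')]

theorem dualPairing_sub_intG_le (hα : α.HolderConjugate α') (hε : 0 < ε) (hδ : 0 < δ)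
    (hw : ContinuousOn w Ω) (hw0 : ∀ x ∈ Ω, 0 ≤ w x) (q : LpVector Ω α) (ξ : LpVector Ω α') :
    dualPairing Ω hα q ξ - intG Ω ε δ α' w ξ ≤ intGConj Ω ε δ α α' w q := by
  have h1 := integrable_inner hα (Lp.memLp q) (Lp.memLp ξ)
  have h2 := integrable_calG hα hε hδ hw hw0 ξ
  rw [intGConj_eq hα hε hδ hw0, dualPairing_apply, intG, ← integral_sub h1 h2]
  refine integral_mono_ae (h1.sub h2) (integrable_conjFormula hα hε hδ hw hw0 q) ?_
  filter_upwards [ae_leb_mem Ω] with x hx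
  exact inner_sub_calG_le hα hε hδ (hw0 x hx) _ _

theorem dualPairing_conjGrad_sub_intG (hα : α.HolderConjugate α') (hε : 0 < ε) (hδ : 0 < δ)
    (hw : ContinuousOn w Ω) (hw0 : ∀ x ∈ Ω, 0 ≤ w x) (q : LpVector Ω α) :
    dualPairing Ω hα q ((memLp_conjGrad hα hε hδ hw hw0 q).toLp _) -
      intG Ω ε δ α' w ((memLp_conjGrad hα hε hδ hw hw0 q).toLp _) =
      intGConj Ω ε δ α α' w q := by
  set ξ := (memLp_conjGrad hα hε hδ hw hw0 q).toLp _ with hξ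
  have h1 := integrable_inner hα (Lp.memLp q) (Lp.memLp ξ)
  have h2 := integrable_calG hα hε hδ hw hw0 ξ
  rw [intGConj_eq hα hε hδ hw0, dualPairing_apply, intG, ← integral_sub h1 h2]
  refine integral_congr_ae ?_
  filter_upwards [ae_leb_mem Ω, (memLp_conjGrad hα hε hδ hw hw0 q).coeFn_toLp] with x hx hx'
  rw [hξ, hx']
  exact inner_conjGrad_sub_calG hα hε hδ (hw0 x hx) _

/-- Fenchel–Young integrates to the upper bound, and the pointwise maximizer `conjGrad` is itself an
admissible `ξ`. -/
theorem iSup_dualPairing_sub_intG (hα : α.HolderConjugate α') (hε : 0 < ε) (hδ : 0 < δ)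
    (hw : ContinuousOn w Ω) (hw0 : ∀ x ∈ Ω, 0 ≤ w x) (q : LpVector Ω α) :
    ⨆ ξ : LpVector Ω α', ((dualPairing Ω hα q ξ - intG Ω ε δ α' w ξ : ℝ) : EReal) =
      ((intGConj Ω ε δ α α' w q : ℝ) : EReal) := by
  refine le_antisymm (iSup_le fun ξ => EReal.coe_le_coe_iff.2
    (dualPairing_sub_intG_le hα hε hδ hw hw0 q ξ)) ?_
  rw [← dualPairing_conjGrad_sub_intG hα hε hδ hw hw0 q]
  exact le_iSup (fun ξ : LpVector Ω α' =>
    ((dualPairing Ω hα q ξ - intG Ω ε δ α' w ξ : ℝ) : EReal)) _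

/-- The functional need not be differentiated. With `ξ_t` the `conjGrad` field of `q + t r`,
equality in Fenchel–Young at `q + t r` and the inequality at `q` give `∫𝓖*(q + t r) - ∫𝓖*(q) ≤ t ∫ r
· ξ_t`. Hence the pairing with `ξ_t` is nonnegative for `t > 0`, and dominated convergence lets `t →
0`. -/
theorem conjGrad_variation (hα : α.HolderConjugate α') (hε : 0 < ε) (hδ : 0 < δ)
    (hw : ContinuousOn w Ω) (hw0 : ∀ x ∈ Ω, 0 ≤ w x) (q r : LpVector Ω α)
    (hmin : ∀ t : ℝ, intGConj Ω ε δ α α' w q ≤ intGConj Ω ε δ α α' w (q + t • r)) :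
    0 ≤ dualPairing Ω hα r ((memLp_conjGrad hα hε hδ hw hw0 q).toLp _) := by
  set Ξ := fun q : LpVector Ω α => (memLp_conjGrad hα hε hδ hw hw0 q).toLp _ with hΞ
  have hΞae : ∀ q : LpVector Ω α, Ξ q =ᵐ[leb Ω] fun x => conjGrad ε δ α w x (q x) :=
    fun q => (memLp_conjGrad hα hε hδ hw hw0 q).coeFn_toLp
  have hpos : ∀ t : ℝ, 0 < t → 0 ≤ dualPairing Ω hα r (Ξ (q + t • r)) := by
    intro t ht
    have h1 := dualPairing_conjGrad_sub_intG hα hε hδ hw hw0 (q + t • r)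
    have h2 := dualPairing_sub_intG_le hα hε hδ hw hw0 q (Ξ (q + t • r))
    have h3 := hmin t
    change dualPairing Ω hα (q + t • r) (Ξ (q + t • r)) - _ = _ at h1
    rw [map_add, map_smul] at h1
    simp only [add_apply, smul_apply, smul_eq_mul] at h1
    have h4 : 0 ≤ t * dualPairing Ω hα r (Ξ (q + t • r)) := by
      change _ - intG Ω ε δ α' w (Ξ (q + t • r)) = _ at h1
      linarith
    exact nonneg_of_mul_nonneg_right h4 ht
  have hlim : Tendsto (fun t : ℝ => dualPairing Ω hα r (Ξ (q + t • r))) (𝓝[>] 0)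
      (𝓝 (dualPairing Ω hα r (Ξ q))) := by
    have e : ∀ t : ℝ, dualPairing Ω hα r (Ξ (q + t • r)) =
        ∫ x, inner ℝ (r x) (conjGrad ε δ α w x (q x + t • r x)) ∂(leb Ω) := by
      intro t
      rw [dualPairing_apply]
      refine integral_congr_ae ?_
      filter_upwards [hΞae (q + t • r), Lp.coeFn_add q (t • r), Lp.coeFn_smul t r]
        with x h1 h2 h3
      rw [h1, h2, Pi.add_apply, h3, Pi.smul_apply]
    have e0 : dualPairing Ω hα r (Ξ q) =
        ∫ x, inner ℝ (r x) (conjGrad ε δ α w x (q x)) ∂(leb Ω) := by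
      rw [dualPairing_apply]
      refine integral_congr_ae ?_
      filter_upwards [hΞae q] with x h1
      rw [h1]
    simp only [e, e0]
    have hs : MemLp (fun x => ‖q x‖ + ‖r x‖) (ENNReal.ofReal α) (leb Ω) :=
      (Lp.memLp q).norm.add (Lp.memLp r).norm
    have hdom : Integrable (fun x => ‖r x‖ * (ε * ‖‖q x‖ + ‖r x‖‖ ^ (α - 1) + w x)) (leb Ω) := by
      have : (ENNReal.ofReal α).HolderConjugate (ENNReal.ofReal α') := hα.ennrealOfReal
      exact (Lp.memLp r).norm.integrable_mul
        (((memLp_norm_rpow_sub_one hα hs).const_mul ε).add (memLp_of_continuousOn hw _))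
    refine tendsto_integral_filter_of_dominated_convergence _ ?_ ?_ hdom ?_
    · refine Eventually.of_forall fun t => (Lp.memLp r).1.inner
        (aestronglyMeasurable_conjGrad hw ?_)
      exact (Lp.memLp q).1.add ((Lp.memLp r).1.const_smul t)
    · have ht : ∀ᶠ t : ℝ in 𝓝[>] 0, t ∈ Ioo (0 : ℝ) 1 := Ioo_mem_nhdsGT one_pos
      filter_upwards [ht] with t ht
      filter_upwards [ae_leb_mem Ω] with x hx
      refine (norm_inner_le_norm _ _).trans (mul_le_mul_of_nonneg_left ?_ (norm_nonneg _))
      refine (norm_conjGrad_le hα.lt hε hδ (hw0 x hx) _).trans ?_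
      have h1 : ‖q x + t • r x‖ ≤ ‖‖q x‖ + ‖r x‖‖ := by
        rw [Real.norm_of_nonneg (by positivity)]
        refine (norm_add_le _ _).trans (add_le_add le_rfl ?_)
        rw [norm_smul, Real.norm_of_nonneg ht.1.le]
        exact mul_le_of_le_one_left (norm_nonneg _) ht.2.le
      have := Real.rpow_le_rpow (norm_nonneg _) h1 hα.sub_one_pos.le
      gcongr
    · refine Eventually.of_forall fun x => ?_
      have hc : Continuous (fun t : ℝ => inner ℝ (r x) (conjGrad ε δ α w x (q x + t • r x))) :=
        continuous_const.inner ((continuous_conjGrad hα.lt hδ x).comp (by fun_prop))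
      have := hc.tendsto 0
      simp only [zero_smul, add_zero] at this
      exact this.mono_left nhdsWithin_le_nhds
  exact ge_of_tendsto hlim (eventually_mem_nhdsWithin.mono fun t ht => hpos t ht)

end IntegralFunctionals

end Beckmann

/-! ### Functional analysis -/

section Banach

variable {X Y : Type*} [NormedAddCommGroup X] [NormedSpace ℝ X] [NormedAddCommGroup Y]
  [NormedSpace ℝ Y]

/-- The bound makes `A` injective with bounded inverse on its range, so `l` descends to a bounded
functional there. Hahn–Banach extends it to `Y`. -/
theorem exists_dual_comp_eq_of_bound (A : X →L[ℝ] Y) {C : ℝ} (hA : ∀ x, ‖x‖ ≤ C * ‖A x‖)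
    (l : StrongDual ℝ X) : ∃ m : StrongDual ℝ Y, m.comp A = l := by
  have hinj : Function.Injective (A : X →ₗ[ℝ] Y) := by
    rw [injective_iff_map_eq_zero]
    intro x hx
    have h := hA x
    have hx' : A x = 0 := hx
    rw [hx', norm_zero, mul_zero] at h
    exact norm_le_zero_iff.1 h
  let e := LinearEquiv.ofInjective (A : X →ₗ[ℝ] Y) hinj
  have he : ∀ y, A (e.symm y) = y := fun y => congrArg Subtype.val (e.apply_symm_apply y)
  let ψ : StrongDual ℝ (LinearMap.range (A : X →ₗ[ℝ] Y)) :=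
    LinearMap.mkContinuous ((l : X →ₗ[ℝ] ℝ).comp e.symm.toLinearMap) (‖l‖ * C) (fun y => by
      have h1 := l.le_opNorm (e.symm y)
      have h2 := hA (e.symm y)
      rw [he y] at h2
      calc ‖l (e.symm y)‖ ≤ ‖l‖ * (C * ‖y‖) :=
            h1.trans (mul_le_mul_of_nonneg_left h2 (norm_nonneg _))
        _ = _ := by ring)
  obtain ⟨m, hm, -⟩ := exists_extension_norm_eq _ ψ
  refine ⟨m, ContinuousLinearMap.ext fun x => ?_⟩
  have h := hm (e x)
  have h2 : ψ (e x) = l x := by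
    change l (e.symm (e x)) = l x
    rw [e.symm_apply_apply]
  rw [h2] at h
  exact h

theorem isClosed_range_of_bound [CompleteSpace X] (A : X →L[ℝ] Y) {C : ℝ}
    (hA : ∀ x, ‖x‖ ≤ C * ‖A x‖) : IsClosed (Set.range A) := by
  have h : AntilipschitzWith C.toNNReal A := AddMonoidHomClass.antilipschitz_of_bound A fun x =>
    (hA x).trans (mul_le_mul_of_nonneg_right (Real.le_coe_toNNReal C) (norm_nonneg _))
  exact h.isClosed_range A.uniformContinuous

/-- Bipolar argument: a functional separating `y` from the closed range is bounded above on a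
subspace, so it vanishes there, yet not at `y`. -/
theorem mem_range_of_forall_dual_eq_zero (A : X →L[ℝ] Y) (hA : IsClosed (Set.range A)) {y : Y}
    (hy : ∀ m : StrongDual ℝ Y, m.comp A = 0 → m y = 0) : y ∈ Set.range A := by
  by_contra hn
  have hconv : Convex ℝ (Set.range A) := by
    have := (LinearMap.range (A : X →ₗ[ℝ] Y)).convex
    rwa [LinearMap.coe_range] at this
  obtain ⟨m, u, h1, h2⟩ := geometric_hahn_banach_closed_point hconv hA hn
  have h3 : ∀ x, m (A x) = 0 := by
    intro x
    by_contra hne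
    -- Scaled to give `m` the value `u + 1`, above the separating level `u`.
    have := h1 _ ⟨((u + 1) / m (A x)) • x, rfl⟩
    rw [map_smul, map_smul, smul_eq_mul, div_mul_cancel₀ _ hne] at this
    linarith
  have h4 := hy m (ContinuousLinearMap.ext h3)
  have h5 := h1 _ ⟨0, rfl⟩
  rw [h3] at h5
  linarith

theorem exists_bound_of_seq_closed_graph [CompleteSpace X] [CompleteSpace Y] (T : X →ₗ[ℝ] Y)
    (hT : ∀ (u : ℕ → X) (x : X) (y : Y), Filter.Tendsto u Filter.atTop (nhds x) →
      Filter.Tendsto (fun n => T (u n)) Filter.atTop (nhds y) → y = T x) :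
    ∃ C : ℝ, 0 ≤ C ∧ ∀ x, ‖T x‖ ≤ C * ‖x‖ :=
  let T' : X →L[ℝ] Y := ⟨T, T.continuous_of_seq_closed_graph hT⟩
  ⟨‖T'‖, norm_nonneg _, T'.le_opNorm⟩

/-- If a linear problem `b y w = J w ν` is uniquely solvable for all data `ν` in the kernel of a
functional `e`, then its solutions depend continuously on `ν`. -/
theorem exists_bound_of_existsUnique {Z W : Type*} [NormedAddCommGroup Z] [NormedSpace ℝ Z]
    [CompleteSpace Z] [CompleteSpace X] (b : X →ₗ[ℝ] W → ℝ) (hb : ∀ w, Continuous fun x => b x w)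
    (e : StrongDual ℝ Z) (J : W → StrongDual ℝ Z)
    (h : ∀ ν : Z, e ν = 0 → ∃! y : X, ∀ w, b y w = J w ν) :
    ∃ C : ℝ, 0 ≤ C ∧ ∀ (y : X) (ν : Z), e ν = 0 → (∀ w, b y w = J w ν) → ‖y‖ ≤ C * ‖ν‖ := by
  let N : Submodule ℝ Z := LinearMap.ker (e : Z →ₗ[ℝ] ℝ)
  have hN : IsClosed (N : Set Z) := isClosed_eq e.continuous continuous_const
  have : CompleteSpace N := hN.completeSpace_coe
  choose S hS hSu using h
  have hNe : ∀ ν : N, e ν.1 = 0 := fun ν => ν.2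
  have hS' : ∀ (ν : N) (w : W), b (S ν.1 (hNe ν)) w = J w ν.1 := fun ν => hS ν.1 (hNe ν)
  let T : N →ₗ[ℝ] X :=
    { toFun := fun ν => S ν.1 (hNe ν)
      map_add' := fun x y => (hSu _ _ _ fun w => by
        rw [map_add, Pi.add_apply, hS', hS']; exact (map_add (J w) x.1 y.1).symm).symm
      map_smul' := fun c x => (hSu _ _ _ fun w => by
        rw [map_smul, Pi.smul_apply, RingHom.id_apply, hS']
        exact (map_smul (J w) c x.1).symm).symm }
  obtain ⟨C, hC0, hC⟩ := exists_bound_of_seq_closed_graph T (by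
    intro ν x y hν hy
    refine hSu x.1 (hNe x) y fun w => ?_
    have h1 := ((hb w).tendsto y).comp hy
    have hc : Continuous (fun ν : N => J w ν.1) := (J w).continuous.comp continuous_subtype_val
    exact tendsto_nhds_unique h1 (((hc.tendsto x).comp hν).congr fun n => (hS' (ν n) w).symm))
  refine ⟨C, hC0, fun y ν hν hy => ?_⟩
  have h1 : y = T ⟨ν, hν⟩ := hSu ν hν y hy
  have h2 := hC ⟨ν, hν⟩
  rwa [← h1] at h2

end Banach

namespace Beckmann

/-! ### Completeness, continuity of `y ↦ ∫ y dμ`, and the Poincaré inequality. -/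

section SobolevSpaces

open Filter Topology

variable {d : ℕ} {Ω : TopologicalSpace.Compacts (Space d)} {p q : ℝ}
  [Fact (1 ≤ ENNReal.ofReal p)] [Fact (1 ≤ ENNReal.ofReal q)]

theorem continuous_integral_mul (hpq : p.HolderConjugate q) {ψ : Space d → ℝ}
    (hψ : MemLp ψ (ENNReal.ofReal q) (leb Ω)) :
    Continuous (fun u : LpScalar Ω p => ∫ x, u x * ψ x ∂(leb Ω)) := by
  have : (ENNReal.ofReal q).HolderConjugate (ENNReal.ofReal p) := hpq.symm.ennrealOfReal
  convert ((ContinuousLinearMap.mul ℝ ℝ).lpPairing (leb Ω) (ENNReal.ofReal q) (ENNReal.ofReal p)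
    (hψ.toLp ψ)).continuous using 2 with u
  rw [ContinuousLinearMap.lpPairing_eq_integral]
  refine integral_congr_ae ?_
  filter_upwards [hψ.coeFn_toLp] with x hx
  rw [hx, ContinuousLinearMap.mul_apply', mul_comm]

theorem continuous_integral_inner_mul (hpq : p.HolderConjugate q) {ψ : Space d → ℝ}
    (hψ : MemLp ψ (ENNReal.ofReal q) (leb Ω)) (v : Space d) :
    Continuous (fun g : LpVector Ω p => ∫ x, inner ℝ (g x) v * ψ x ∂(leb Ω)) := by
  have : (ENNReal.ofReal q).HolderConjugate (ENNReal.ofReal p) := hpq.symm.ennrealOfReal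
  have hψv : MemLp (fun x => ψ x • v) (ENNReal.ofReal q) (leb Ω) := by
    refine MemLp.of_le_mul (c := ‖v‖) hψ (hψ.1.smul_const v) (Eventually.of_forall fun x => ?_)
    rw [norm_smul, mul_comm]
  convert (dualPairing Ω hpq.symm (hψv.toLp _)).continuous using 2 with g
  rw [dualPairing_apply]
  refine integral_congr_ae ?_
  filter_upwards [hψv.coeFn_toLp] with x hx
  rw [hx, real_inner_smul_left, real_inner_comm, mul_comm]

theorem isClosed_sobolev (hpq : p.HolderConjugate q) :
    IsClosed (Sobolev Ω p : Set (LpScalar Ω p × LpVector Ω p)) := by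
  have e : (Sobolev Ω p : Set (LpScalar Ω p × LpVector Ω p)) =
      ⋂ (φ : Space d → ℝ) (_ : IsTest Ω φ) (v : Space d),
        {u | ∫ x, u.1 x * fderiv ℝ φ x v ∂(leb Ω) = - ∫ x, inner ℝ (u.2 x) v * φ x ∂(leb Ω)} := by
    ext u
    simp only [mem_iInter]
    rfl
  rw [e]
  refine isClosed_iInter fun φ => isClosed_iInter fun hφ => isClosed_iInter fun v => ?_
  have h1 : MemLp (fun x => fderiv ℝ φ x v) (ENNReal.ofReal q) (leb Ω) :=
    (hφ.continuous_fderiv v).memLp_of_hasCompactSupport (hφ.hasCompactSupport_fderiv v)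
  have h2 : MemLp φ (ENNReal.ofReal q) (leb Ω) :=
    hφ.1.continuous.memLp_of_hasCompactSupport hφ.2.1
  exact isClosed_eq ((continuous_integral_mul hpq h1).comp continuous_fst)
    ((continuous_integral_inner_mul hpq h2 v).comp continuous_snd).neg

theorem isClosed_sobolevMeanZero (hpq : p.HolderConjugate q) :
    IsClosed (SobolevMeanZero Ω p : Set (LpScalar Ω p × LpVector Ω p)) := by
  have h : Continuous (fun u : LpScalar Ω p => ∫ x, u x ∂(leb Ω)) := by
    simpa using continuous_integral_mul (Ω := Ω) hpq (memLp_const (1 : ℝ))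
  exact (isClosed_sobolev hpq).inter
    (isClosed_eq (h.comp continuous_fst) continuous_const)

theorem completeSpace_sobolevMeanZero (hpq : p.HolderConjugate q) :
    CompleteSpace (SobolevMeanZero Ω p) :=
  (isClosed_sobolevMeanZero hpq).completeSpace_coe

theorem isContinuousRep_continuousRep {u : Space d → ℝ}
    (h : ∃ c : C(Ω, ℝ), IsContinuousRep u c) : IsContinuousRep u (continuousRep (Ω := Ω) u) := by
  unfold continuousRep
  rw [dif_pos h]
  exact h.choose_spec

/-- Passage to the continuous representative, if it always exists. -/
noncomputable def repLinear (hΩ' : closure (interior (Ω : Set (Space d))) = Ω)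
    (hrep : ∀ u : Sobolev Ω p, ∃ c : C(Ω, ℝ), IsContinuousRep u.1.1 c) :
    SobolevMeanZero Ω p →ₗ[ℝ] C(Ω, ℝ) :=
  have hspec : ∀ u : SobolevMeanZero Ω p, IsContinuousRep u.1.1 (continuousRep u.1.1) :=
    fun u => isContinuousRep_continuousRep (hrep (meanZeroToSobolev u))
  { toFun := fun u => continuousRep u.1.1
    map_add' := fun u v => by
      refine (hspec (u + v)).unique hΩ' ?_
      filter_upwards [hspec u, hspec v, Lp.coeFn_add u.1.1 v.1.1] with x h1 h2 h3 hx
      change _ = (u.1.1 + v.1.1 : LpScalar Ω p) x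
      rw [h3, ContinuousMap.add_apply, h1 hx, h2 hx, Pi.add_apply]
    map_smul' := fun a u => by
      refine (hspec (a • u)).unique hΩ' ?_
      filter_upwards [hspec u, Lp.coeFn_smul a u.1.1] with x h1 h3 hx
      change _ = (a • u.1.1 : LpScalar Ω p) x
      rw [h3, RingHom.id_apply, ContinuousMap.smul_apply, h1 hx, Pi.smul_apply] }

/-- Closed graph: `L^p` convergence has an almost everywhere convergent subsequence, so a uniform
limit of representatives represents the `L^p` limit. -/
theorem continuous_repLinear (hpq : p.HolderConjugate q)
    (hΩ' : closure (interior (Ω : Set (Space d))) = Ω)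
    (hrep : ∀ u : Sobolev Ω p, ∃ c : C(Ω, ℝ), IsContinuousRep u.1.1 c) :
    Continuous (repLinear hΩ' hrep) := by
  have := completeSpace_sobolevMeanZero (Ω := Ω) hpq
  have hspec : ∀ u : SobolevMeanZero Ω p, IsContinuousRep u.1.1 (repLinear hΩ' hrep u) :=
    fun u => isContinuousRep_continuousRep (hrep (meanZeroToSobolev u))
  refine LinearMap.continuous_of_seq_closed_graph _ fun u x c hu hc => ?_
  refine IsContinuousRep.unique hΩ' (u := x.1.1) ?_ (hspec x)
  have h1 : Tendsto (fun n => (u n).1.1) atTop (𝓝 x.1.1) :=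
    ((continuous_fst.comp continuous_subtype_val).tendsto x).comp hu
  obtain ⟨ns, hns, hae⟩ := (tendstoInMeasure_of_tendsto_Lp h1).exists_seq_tendsto_ae
  filter_upwards [hae, ae_all_iff.2 fun n => hspec (u n)] with z hz1 hz2 hz
  have h2 : Tendsto (fun n => repLinear hΩ' hrep (u (ns n)) ⟨z, hz⟩) atTop (𝓝 (c ⟨z, hz⟩)) :=
    (((continuous_eval_const (⟨z, hz⟩ : Ω)).tendsto c).comp hc).comp
      hns.tendsto_atTop
  refine tendsto_nhds_unique h2 (hz1.congr fun n => ?_)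
  exact (hz2 (ns n) hz).symm

/-- Integration of continuous functions on `Ω` as a functional. -/
noncomputable def integralDual (μ : Measure Ω) [IsFiniteMeasure μ] : StrongDual ℝ C(Ω, ℝ) :=
  LinearMap.mkContinuous
    { toFun := fun c => ∫ z, c z ∂μ
      map_add' := fun a b => integral_add
        (a.continuous.integrable_of_hasCompactSupport (HasCompactSupport.of_compactSpace _))
        (b.continuous.integrable_of_hasCompactSupport (HasCompactSupport.of_compactSpace _))
      map_smul' := fun a b => integral_const_mul _ _ }
    (μ.real univ) (fun c => by
      rw [mul_comm]
      exact norm_integral_le_of_norm_le_const (Eventually.of_forall c.norm_coe_le_norm))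

theorem exists_dual_eq_measurePairing (hpq : p.HolderConjugate q)
    (hΩ' : closure (interior (Ω : Set (Space d))) = Ω)
    (hrep : ∀ u : Sobolev Ω p, ∃ c : C(Ω, ℝ), IsContinuousRep u.1.1 c)
    (μp μm : Measure Ω) [IsFiniteMeasure μp] [IsFiniteMeasure μm] :
    ∃ l : StrongDual ℝ (SobolevMeanZero Ω p), ∀ φ, l φ = measurePairing μp μm φ :=
  ⟨(integralDual μp - integralDual μm).comp ⟨repLinear hΩ' hrep, continuous_repLinear hpq hΩ' hrep⟩,
    fun _ => rfl⟩

theorem divPairing_eq (hpq : p.HolderConjugate q) (r : LpVector Ω p) (φ : SobolevMeanZero Ω q) :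
    divPairing r φ = - dualPairing Ω hpq r (grad Ω q φ) := by
  rw [divPairing, dualPairing_apply]

/-- The functional `u ↦ -∫ r · ∇u` on `W^{1,q}`. -/
noncomputable def divDual (hpq : p.HolderConjugate q) (r : LpVector Ω p) :
    StrongDual ℝ (Sobolev Ω q) :=
  (dualPairing Ω hpq (-r)).comp
    ((ContinuousLinearMap.snd ℝ (LpScalar Ω q) (LpVector Ω q)).comp (Sobolev Ω q).subtypeL)

theorem divDual_mem_dualPerp (hpq : p.HolderConjugate q) (r : LpVector Ω p) :
    divDual hpq r ∈ DualPerp Ω q := by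
  change dualPairing Ω hpq (-r) 0 = 0
  rw [map_zero]

theorem exists_norm_divDual_le (hpq : p.HolderConjugate q) :
    ∃ C : ℝ, ∀ r : LpVector Ω p, ‖divDual hpq r‖ ≤ C * ‖r‖ := by
  refine ⟨‖dualPairing Ω hpq‖, fun r => ContinuousLinearMap.opNorm_le_bound _ (by positivity)
    fun u => ?_⟩
  have h1 : ‖u.1.2‖ ≤ ‖u‖ := norm_snd_le u.1
  have h2 := (dualPairing Ω hpq).le_opNorm₂ (-r) u.1.2
  rw [norm_neg] at h2
  exact h2.trans (mul_le_mul_of_nonneg_left h1 (by positivity))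

/-- The **Poincaré inequality**, from the solvability of the Laplace equation. -/
theorem exists_norm_le_norm_grad (hpq : p.HolderConjugate q) (hlap : LaplaceSolvable Ω q p) :
    ∃ C : ℝ, ∀ y : SobolevMeanZero Ω p, ‖y‖ ≤ C * ‖grad Ω p y‖ := by
  have := completeSpace_sobolevMeanZero (Ω := Ω) hpq
  let b : SobolevMeanZero Ω p →ₗ[ℝ] SobolevMeanZero Ω q → ℝ :=
    { toFun := fun y φ => -dualPairing Ω hpq (grad Ω p y) (grad Ω q φ)
      map_add' := fun x y => funext fun φ => by
        rw [map_add, map_add, add_apply, Pi.add_apply, neg_add]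
      map_smul' := fun c x => funext fun φ => by
        rw [map_smul, map_smul, smul_apply, Pi.smul_apply, RingHom.id_apply, smul_neg] }
  have hb : ∀ φ, Continuous fun y => b y φ := fun φ =>
    (((ContinuousLinearMap.apply ℝ ℝ (grad Ω q φ)).comp
      ((dualPairing Ω hpq).comp (grad Ω p))).continuous).neg
  obtain ⟨C, hC0, hC⟩ := exists_bound_of_existsUnique (Z := StrongDual ℝ (Sobolev Ω q)) b hb
    (ContinuousLinearMap.apply ℝ ℝ (sobolevOne Ω q))
    (fun φ => ContinuousLinearMap.apply ℝ ℝ (meanZeroToSobolev φ))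
    (fun ν hν => by
      obtain ⟨y, hy, hyu⟩ := hlap ν hν
      refine ⟨y, fun φ => ?_, fun z hz => hyu z fun φ => ?_⟩
      · exact (divPairing_eq hpq _ _).symm.trans (hy φ)
      · exact (divPairing_eq hpq _ _).trans (hz φ))
  obtain ⟨D, hD⟩ := exists_norm_divDual_le (Ω := Ω) hpq
  refine ⟨C * D, fun y => ?_⟩
  -- Every `y` solves the equation with its own weak Laplacian as data, and the dual norm of that
  -- data is bounded by `‖∇y‖`.
  have h1 := hC y (divDual hpq (grad Ω p y)) (divDual_mem_dualPerp hpq _) fun φ => by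
    change -(dualPairing Ω hpq (grad Ω p y) (grad Ω q φ)) =
      dualPairing Ω hpq (-(grad Ω p y)) (grad Ω q φ)
    rw [map_neg, neg_apply]
  refine h1.trans ?_
  rw [mul_assoc]
  exact mul_le_mul_of_nonneg_left (hD _) hC0

end SobolevSpaces

/-- `α(d-1) < d` rearranges to `d(α-1) < α`, and `α' = α/(α-1)`. -/
theorem natCast_lt_of_mul_lt {d : ℕ} {α α' : ℝ} (hα : α.HolderConjugate α')
    (hαd : α * ((d : ℝ) - 1) < d) :
    (d : ℝ) < α' := by
  rw [hα.conjugate_eq, lt_div_iff₀ hα.sub_one_pos]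
  linarith

/-! ### Dual minimizer, recovery of the primal minimizer, and Fenchel conjugates. -/

section Duality

open Filter Topology

variable {d : ℕ} {Ω : TopologicalSpace.Compacts (Space d)} {ε δ α α' : ℝ} {w : Space d → ℝ}
  [Fact (1 ≤ ENNReal.ofReal α)] [Fact (1 ≤ ENNReal.ofReal α')]
  {μp μm : Measure Ω}

theorem exists_dualPairing_eq (hα : α.HolderConjugate α') (ν : StrongDual ℝ (LpVector Ω α')) :
    ∃ q : LpVector Ω α, dualPairing Ω hα q = ν := by
  obtain ⟨q, hq, -⟩ := existsUnique_dual_eq_integral_inner hα.symm ν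
  exact ⟨q, ContinuousLinearMap.ext fun ξ => by rw [dualPairing_apply, hq]⟩

theorem feasible_iff (hα : α.HolderConjugate α') (q : LpVector Ω α) :
    Feasible α' μp μm q ↔ ∀ φ : SobolevMeanZero Ω α',
      dualPairing Ω hα q (grad Ω α' φ) = - measurePairing μp μm φ := by
  refine forall_congr' fun φ => ?_
  rw [divPairing_eq hα]
  constructor <;> intro h <;> linarith

/-- By Poincaré, `φ ↦ ∫ φ dμ` factors through `∇φ`. Hahn–Banach and Riesz then give the field. -/
theorem exists_feasible (hα : α.HolderConjugate α') (hlap : LaplaceSolvable Ω α α')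
    (l : StrongDual ℝ (SobolevMeanZero Ω α')) (hl : ∀ φ, l φ = measurePairing μp μm φ) :
    ∃ q : LpVector Ω α, Feasible α' μp μm q := by
  obtain ⟨C, hC⟩ := exists_norm_le_norm_grad hα.symm hlap
  obtain ⟨m, hm⟩ := exists_dual_comp_eq_of_bound (grad Ω α') hC l
  obtain ⟨q, hq⟩ := exists_dualPairing_eq hα (-m)
  refine ⟨q, (feasible_iff hα q).2 fun φ => ?_⟩
  rw [hq, ← hl, ← hm]
  rfl

/-- Direct method in the weak-* topology of the dual of `L^α'`: coercivity confines competitors no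
worse than `q₀` to a ball, which is compact by Banach–Alaoglu, and the divergence constraint is
weak-* closed. -/
theorem exists_minimizer_intGConj (hα : α.HolderConjugate α') (hε : 0 < ε) (hδ : 0 < δ)
    (hw : ContinuousOn w Ω) (hw0 : ∀ x ∈ Ω, 0 ≤ w x) (hlap : LaplaceSolvable Ω α α')
    (l : StrongDual ℝ (SobolevMeanZero Ω α')) (hl : ∀ φ, l φ = measurePairing μp μm φ) :
    ∃ q : LpVector Ω α, Feasible α' μp μm q ∧ ∀ r : LpVector Ω α, Feasible α' μp μm r →
      intGConj Ω ε δ α α' w q ≤ intGConj Ω ε δ α α' w r := by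
  obtain ⟨q₀, hq₀⟩ := exists_feasible hα hlap l hl
  obtain ⟨R, hR⟩ := exists_norm_le_of_intGConj_le hα hε hδ hw hw0 (intGConj Ω ε δ α α' w q₀)
  set ρ := ‖dualPairing Ω hα‖ * R with hρ
  -- Written as a supremum of weak-* continuous affine functions, the objective is lower
  -- semicontinuous at once.
  let Φ : WeakDual ℝ (LpVector Ω α') → EReal :=
    fun m => ⨆ ξ : LpVector Ω α', ((m ξ - intG Ω ε δ α' w ξ : ℝ) : EReal)
  have hΦ : LowerSemicontinuous Φ := lowerSemicontinuous_iSup fun ξ =>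
    (continuous_coe_real_ereal.comp
      ((WeakDual.eval_continuous ξ).sub continuous_const)).lowerSemicontinuous
  have hΦq : ∀ q : LpVector Ω α, Φ (StrongDual.toWeakDual (dualPairing Ω hα q)) =
      ((intGConj Ω ε δ α α' w q : ℝ) : EReal) := fun q => iSup_dualPairing_sub_intG hα hε hδ hw hw0 q
  let F : Set (WeakDual ℝ (LpVector Ω α')) :=
    ⋂ φ : SobolevMeanZero Ω α', {m | m (grad Ω α' φ) = - measurePairing μp μm φ}
  have hF : IsClosed F := isClosed_iInter fun φ =>
    isClosed_eq (WeakDual.eval_continuous _) continuous_const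
  have hFq : ∀ q : LpVector Ω α, StrongDual.toWeakDual (dualPairing Ω hα q) ∈ F ↔
      Feasible α' μp μm q := fun q => by
    rw [feasible_iff hα, mem_iInter]
    rfl
  have hK := (WeakDual.isCompact_closedBall (𝕜 := ℝ) (0 : StrongDual ℝ (LpVector Ω α')) ρ)
    |>.inter_right hF
  have hball : ∀ r : LpVector Ω α, Feasible α' μp μm r →
      intGConj Ω ε δ α α' w r ≤ intGConj Ω ε δ α α' w q₀ →
      StrongDual.toWeakDual (dualPairing Ω hα r) ∈
        WeakDual.toStrongDual ⁻¹' Metric.closedBall (0 : StrongDual ℝ (LpVector Ω α')) ρ ∩ F := by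
    refine fun r hr hle => ⟨?_, (hFq r).2 hr⟩
    change dualPairing Ω hα r ∈ Metric.closedBall (0 : StrongDual ℝ (LpVector Ω α')) ρ
    rw [mem_closedBall_zero_iff]
    exact ((dualPairing Ω hα).le_opNorm r).trans
      (mul_le_mul_of_nonneg_left (hR r hle) (norm_nonneg _))
  obtain ⟨m, hm, hmin⟩ := (hΦ.lowerSemicontinuousOn _).exists_isMinOn ⟨_, hball q₀ hq₀ le_rfl⟩ hK
  obtain ⟨q, hq⟩ := exists_dualPairing_eq hα (WeakDual.toStrongDual m)
  have hqm : StrongDual.toWeakDual (dualPairing Ω hα q) = m := by rw [hq]; rfl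
  rw [← hqm] at hm hmin
  have hmin' : ∀ r : LpVector Ω α, Feasible α' μp μm r →
      intGConj Ω ε δ α α' w r ≤ intGConj Ω ε δ α α' w q₀ →
      intGConj Ω ε δ α α' w q ≤ intGConj Ω ε δ α α' w r := fun r hr hle => by
    have := hmin (hball r hr hle)
    change Φ _ ≤ Φ _ at this
    rwa [hΦq, hΦq, EReal.coe_le_coe_iff] at this
  refine ⟨q, (hFq q).1 hm.2, fun r hr => ?_⟩
  rcases le_total (intGConj Ω ε δ α α' w r) (intGConj Ω ε δ α α' w q₀) with h | h
  · exact hmin' r hr h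
  · exact (hmin' q₀ hq₀ le_rfl).trans h

/-- Weak duality. -/
theorem neg_intGConj_le_calJ (hα : α.HolderConjugate α') (hε : 0 < ε) (hδ : 0 < δ)
    (hw : ContinuousOn w Ω) (hw0 : ∀ x ∈ Ω, 0 ≤ w x) {q : LpVector Ω α}
    (hq : Feasible α' μp μm q) (y : SobolevMeanZero Ω α') :
    -(intGConj Ω ε δ α α' w q) ≤ calJ ε δ α' w μp μm y := by
  have h1 := dualPairing_sub_intG_le hα hε hδ hw hw0 q (-(grad Ω α' y))
  rw [map_neg, (feasible_iff hα q).1 hq y, neg_neg] at h1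
  rw [calJ]
  linarith

/-- A minimizer of the dual problem yields a function without duality gap. -/
theorem exists_calJ_eq_neg_intGConj (hα : α.HolderConjugate α') (hε : 0 < ε) (hδ : 0 < δ)
    (hw : ContinuousOn w Ω) (hw0 : ∀ x ∈ Ω, 0 ≤ w x) (hlap : LaplaceSolvable Ω α α')
    {q : LpVector Ω α} (hq : Feasible α' μp μm q)
    (hmin : ∀ r : LpVector Ω α, Feasible α' μp μm r →
      intGConj Ω ε δ α α' w q ≤ intGConj Ω ε δ α α' w r) :
    ∃ y : SobolevMeanZero Ω α', calJ ε δ α' w μp μm y = -(intGConj Ω ε δ α α' w q) := by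
  have := completeSpace_sobolevMeanZero (Ω := Ω) hα.symm
  obtain ⟨C, hC⟩ := exists_norm_le_norm_grad hα.symm hlap
  set ξ := (memLp_conjGrad hα hε hδ hw hw0 q).toLp _ with hξ
  have hvar : ∀ r : LpVector Ω α, (∀ φ, dualPairing Ω hα r (grad Ω α' φ) = 0) →
      0 ≤ dualPairing Ω hα r ξ := fun r hr =>
    conjGrad_variation hα hε hδ hw hw0 q r fun t => hmin _ ((feasible_iff hα _).2 fun φ => by
      rw [map_add, map_smul, add_apply, smul_apply, hr, smul_zero, add_zero,
        (feasible_iff hα q).1 hq φ])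
  -- Admissible variations form a subspace; using both `r` and `-r` upgrades the inequality to `∫ r
  -- · ξ = 0`, so `ξ` is a gradient.
  obtain ⟨y, hy⟩ := mem_range_of_forall_dual_eq_zero (grad Ω α') (isClosed_range_of_bound _ hC)
    (y := ξ) (fun m hm => by
      obtain ⟨r, rfl⟩ := exists_dualPairing_eq hα m
      have h0 : ∀ φ, dualPairing Ω hα r (grad Ω α' φ) = 0 := fun φ => DFunLike.congr_fun hm φ
      have h1 := hvar r h0
      have h2 := hvar (-r) fun φ => by rw [map_neg, neg_apply, h0, neg_zero]
      rw [map_neg, neg_apply] at h2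
      linarith)
  -- The objective evaluates `𝓖` at minus the gradient, hence the sign.
  refine ⟨-y, ?_⟩
  have h1 := dualPairing_conjGrad_sub_intG hα hε hδ hw hw0 q
  have h2 := (feasible_iff hα q).1 hq (-y)
  rw [map_neg, map_neg, hy] at h2
  rw [calJ, map_neg, neg_neg, hy]
  linarith

theorem fenchelConj_gPart (hα : α.HolderConjugate α') (hε : 0 < ε) (hδ : 0 < δ)
    (hw : ContinuousOn w Ω) (hw0 : ∀ x ∈ Ω, 0 ≤ w x) (q : LpVector Ω α) :
    fenchelConj (gPart ε δ w) (dualPairing Ω hα q) = ((intGConj Ω ε δ α α' w q : ℝ) : EReal) := by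
  rw [← iSup_dualPairing_sub_intG hα hε hδ hw hw0 q]
  rfl

theorem fenchelConj_fPart_of_feasible (hα : α.HolderConjugate α') {q : LpVector Ω α}
    (hq : Feasible α' μp μm q) :
    fenchelConj (fPart μp μm) ((-dualPairing Ω hα q).comp (negGrad Ω α')) = 0 := by
  have h : ∀ y, ((((-dualPairing Ω hα q).comp (negGrad Ω α')) y : ℝ) : EReal) - fPart μp μm y =
      0 := fun y => by
    have e : ((-dualPairing Ω hα q).comp (negGrad Ω α')) y = - measurePairing μp μm y := by
      change -(dualPairing Ω hα q (-(grad Ω α' y))) = _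
      rw [map_neg, neg_neg, (feasible_iff hα q).1 hq y]
    rw [e, fPart, ← EReal.coe_sub, sub_self, EReal.coe_zero]
  rw [fenchelConj]
  simp only [h]
  exact iSup_const

/-- The conjugate of a linear function at another functional is the supremum of their difference; a
nonzero linear difference is unbounded. -/
theorem fenchelConj_fPart_of_not_feasible (hα : α.HolderConjugate α')
    (l : StrongDual ℝ (SobolevMeanZero Ω α')) (hl : ∀ φ, l φ = measurePairing μp μm φ)
    {q : LpVector Ω α} (hq : ¬ Feasible α' μp μm q) :
    fenchelConj (fPart μp μm) ((-dualPairing Ω hα q).comp (negGrad Ω α')) = ⊤ := by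
  rw [feasible_iff hα] at hq
  push Not at hq
  obtain ⟨φ, hφ⟩ := hq
  set a := dualPairing Ω hα q (grad Ω α' φ) + l φ with ha
  have ha0 : a ≠ 0 := fun h => hφ (by rw [← hl]; linarith)
  rw [EReal.eq_top_iff_forall_lt]
  intro c
  -- Scaling the violating `φ` by `(c + 1)/a` makes the difference equal to `c + 1`.
  refine lt_of_lt_of_le ?_ (le_iSup (fun y =>
    ((((-dualPairing Ω hα q).comp (negGrad Ω α')) y : ℝ) : EReal) - fPart μp μm y)
    (((c + 1) / a) • φ))
  have e : ((-dualPairing Ω hα q).comp (negGrad Ω α')) (((c + 1) / a) • φ) -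
      -(measurePairing μp μm (((c + 1) / a) • φ)) = c + 1 := by
    change -(dualPairing Ω hα q (-(grad Ω α' (((c + 1) / a) • φ)))) - _ = _
    rw [map_neg, neg_neg, ← hl, map_smul, map_smul, map_smul, sub_neg_eq_add, ← smul_add,
      smul_eq_mul, ← ha, div_mul_cancel₀ _ ha0]
  simp only [fPart]
  rw [← EReal.coe_sub, e]
  exact EReal.coe_lt_coe_iff.2 (by linarith)

theorem fenchelDual_eq (hα : α.HolderConjugate α') (hε : 0 < ε) (hδ : 0 < δ)
    (hw : ContinuousOn w Ω) (hw0 : ∀ x ∈ Ω, 0 ≤ w x)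
    (l : StrongDual ℝ (SobolevMeanZero Ω α')) (hl : ∀ φ, l φ = measurePairing μp μm φ)
    (q : LpVector Ω α) :
    fenchelDual (fPart μp μm) (gPart ε δ w) (negGrad Ω α') (-dualPairing Ω hα q) =
      -(beckmannObjective ε δ α α' w μp μm q) := by
  rw [fenchelDual, neg_neg, fenchelConj_gPart hα hε hδ hw hw0, beckmannObjective]
  split_ifs with h
  · rw [fenchelConj_fPart_of_feasible hα h, neg_zero, zero_sub]
  -- The conjugate of `g` is finite, so subtracting it from `⊥` is unambiguous.
  · rw [fenchelConj_fPart_of_not_feasible hα l hl h, EReal.neg_top, sub_eq_add_neg,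
      EReal.bot_add]

end Duality

end Beckmann

theorem mainTheorem4 (d : ℕ) (hd : 1 ≤ d)
    (Ω : TopologicalSpace.Compacts (Beckmann.Space d))
    (hΩ : Beckmann.IsBoundedLipschitzDomain (interior (Ω : Set (Beckmann.Space d))))
    (hΩ' : closure (interior (Ω : Set (Beckmann.Space d))) = Ω)
    (w : Beckmann.Space d → ℝ) (hw : ContinuousOn w Ω) (hw0 : ∀ x ∈ Ω, 0 ≤ w x)
    (α α' : ℝ) (hα : α.HolderConjugate α') (hαd : α * ((d : ℝ) - 1) < d)
    [Fact (1 ≤ ENNReal.ofReal α)] [Fact (1 ≤ ENNReal.ofReal α')]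
    (hlap : Beckmann.LaplaceSolvable Ω α α')
    (ε δ : ℝ) (hε : 0 < ε) (hδ : 0 < δ)
    (μp μm : MeasureTheory.Measure Ω)
    [MeasureTheory.IsProbabilityMeasure μp] [MeasureTheory.IsProbabilityMeasure μm] :
    -- All objects are well defined: functions in `W^{1,α'}` have a unique continuous
    -- representative on `Ω`, the conjugate integrand is finite and explicit, and both
    -- integrands are integrable.
    (∀ u : Beckmann.Sobolev Ω α', ∃! c : C(Ω, ℝ), Beckmann.IsContinuousRep u.1.1 c) ∧
    (∀ x ∈ Ω, ∀ q : Beckmann.Space d, Beckmann.calGConj ε δ α' w x q =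
      ((if ‖q‖ ≤ δ then ‖q‖ ^ 2 * (w x / (2 * δ)) - δ * w x
        else ε / α * (‖q‖ - δ) ^ α - 3 / 2 * δ * w x + ‖q‖ * w x : ℝ) : EReal)) ∧
    (∀ ξ : Beckmann.LpVector Ω α',
      MeasureTheory.Integrable (fun x => Beckmann.calG ε δ α' w x (ξ x)) (Beckmann.leb Ω)) ∧
    (∀ q : Beckmann.LpVector Ω α,
      MeasureTheory.Integrable (fun x => (Beckmann.calGConj ε δ α' w x (q x)).toReal)
        (Beckmann.leb Ω)) ∧
    -- Predual: with `f(y) = -∫ y dμ`, `g(ξ) = ∫ 𝓖(ξ)` and `A = -∇`, the Fenchel primal problem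
    -- is `min 𝓙`, and its Fenchel dual is the doubly regularized problem, under the
    -- identification of the dual of `L^{α'}` with `L^α`.
    ((∀ y : Beckmann.SobolevMeanZero Ω α',
        Beckmann.fenchelPrimal (Beckmann.fPart μp μm) (Beckmann.gPart ε δ w)
          (Beckmann.negGrad Ω α') y =
        ((Beckmann.calJ ε δ α' w μp μm y : ℝ) : EReal)) ∧
      (∀ ν : StrongDual ℝ (Beckmann.LpVector Ω α'), ∃! q : Beckmann.LpVector Ω α,
        ∀ ξ, ν ξ = - ∫ x, inner ℝ (q x) (ξ x) ∂(Beckmann.leb Ω)) ∧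
      (∀ q : Beckmann.LpVector Ω α, ∃! ν : StrongDual ℝ (Beckmann.LpVector Ω α'),
        ∀ ξ, ν ξ = - ∫ x, inner ℝ (q x) (ξ x) ∂(Beckmann.leb Ω)) ∧
      (∀ (ν : StrongDual ℝ (Beckmann.LpVector Ω α')) (q : Beckmann.LpVector Ω α),
        (∀ ξ, ν ξ = - ∫ x, inner ℝ (q x) (ξ x) ∂(Beckmann.leb Ω)) →
        Beckmann.fenchelDual (Beckmann.fPart μp μm) (Beckmann.gPart ε δ w)
          (Beckmann.negGrad Ω α') ν = -(Beckmann.beckmannObjective ε δ α α' w μp μm q))) ∧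
    -- Strong duality: equal optimal values, attained on both sides.
    ((⨅ y : Beckmann.SobolevMeanZero Ω α', ((Beckmann.calJ ε δ α' w μp μm y : ℝ) : EReal)) =
      -(⨅ q : Beckmann.LpVector Ω α, Beckmann.beckmannObjective ε δ α α' w μp μm q)) ∧
    (∃ y : Beckmann.SobolevMeanZero Ω α', ∀ z : Beckmann.SobolevMeanZero Ω α',
      Beckmann.calJ ε δ α' w μp μm y ≤ Beckmann.calJ ε δ α' w μp μm z) ∧
    (∃ q : Beckmann.LpVector Ω α, Beckmann.Feasible α' μp μm q ∧
      ∀ r : Beckmann.LpVector Ω α, Beckmann.Feasible α' μp μm r →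
        Beckmann.intGConj Ω ε δ α α' w q ≤ Beckmann.intGConj Ω ε δ α α' w r) := by
  have hα' : (d : ℝ) < α' := Beckmann.natCast_lt_of_mul_lt hα hαd
  have hrep := Beckmann.exists_isContinuousRep hα.symm hα' hΩ hΩ'
  obtain ⟨l, hl⟩ := Beckmann.exists_dual_eq_measurePairing hα.symm hΩ' hrep μp μm
  obtain ⟨q, hq, hmin⟩ :=
    Beckmann.exists_minimizer_intGConj (μp := μp) (μm := μm) hα hε hδ hw hw0 hlap l hl
  obtain ⟨y, hy⟩ := Beckmann.exists_calJ_eq_neg_intGConj hα hε hδ hw hw0 hlap hq hmin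
  have hymin : ∀ z, Beckmann.calJ ε δ α' w μp μm y ≤ Beckmann.calJ ε δ α' w μp μm z := fun z =>
    hy.trans_le (Beckmann.neg_intGConj_le_calJ hα hε hδ hw hw0 hq z)
  -- The sign in the correspondence makes `-ν` the functional represented by `q`, so `g*(-ν)`
  -- becomes `∫ 𝓖*(x, q)`.
  have hneg : ∀ (ν : StrongDual ℝ (Beckmann.LpVector Ω α')) (q : Beckmann.LpVector Ω α),
      (∀ ξ, ν ξ = - ∫ x, inner ℝ (q x) (ξ x) ∂(Beckmann.leb Ω)) ↔
        ν = -Beckmann.dualPairing Ω hα q := fun ν q => by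
    constructor
    · intro h
      ext ξ
      rw [h, neg_apply, Beckmann.dualPairing_apply]
    · rintro rfl ξ
      rw [neg_apply, Beckmann.dualPairing_apply]
  refine ⟨fun u => ?_, fun x hx q => ?_, fun ξ => Beckmann.integrable_calG hα hε hδ hw hw0 ξ,
    fun q => ?_, ⟨fun y => ?_, fun ν => ?_, fun q => ?_, fun ν q h => ?_⟩, ?_, ⟨y, hymin⟩,
    ⟨q, hq, hmin⟩⟩
  · obtain ⟨c, hc⟩ := hrep u
    exact ⟨c, hc, fun c' hc' => hc'.unique hΩ' hc⟩
  · rw [Beckmann.calGConj_eq hα hε hδ (hw0 x hx), Beckmann.conjFormula_eq_ite hα.pos]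
  · exact (Beckmann.integrable_conjFormula hα hε hδ hw hw0 q).congr
      (Beckmann.toReal_calGConj_ae_eq hα hε hδ hw0 q).symm
  · rw [Beckmann.fenchelPrimal, Beckmann.fPart, Beckmann.gPart, ← EReal.coe_add, add_comm,
      ← sub_eq_add_neg]
    rfl
  · obtain ⟨q, hq, hqu⟩ := existsUnique_dual_eq_integral_inner hα.symm (-ν)
    refine ⟨q, fun ξ => ?_, fun r hr => hqu r fun ξ => ?_⟩
    · rw [← hq ξ, neg_apply, neg_neg]
    · rw [neg_apply, hr ξ, neg_neg]
  · exact ⟨_, (hneg _ q).2 rfl, fun ν hν => (hneg ν q).1 hν⟩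
  · rw [(hneg ν q).1 h]
    exact Beckmann.fenchelDual_eq hα hε hδ hw hw0 l hl q
  · have h1 : (⨅ z : Beckmann.SobolevMeanZero Ω α',
        ((Beckmann.calJ ε δ α' w μp μm z : ℝ) : EReal)) =
        ((Beckmann.calJ ε δ α' w μp μm y : ℝ) : EReal) :=
      le_antisymm (iInf_le _ y) (le_iInf fun z => EReal.coe_le_coe_iff.2 (hymin z))
    have h2 : (⨅ r : Beckmann.LpVector Ω α, Beckmann.beckmannObjective ε δ α α' w μp μm r) =
        ((Beckmann.intGConj Ω ε δ α α' w q : ℝ) : EReal) := by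
      refine le_antisymm ((iInf_le _ q).trans_eq (if_pos hq)) (le_iInf fun r => ?_)
      rw [Beckmann.beckmannObjective]
      split_ifs with hr
      · exact EReal.coe_le_coe_iff.2 (hmin r hr)
      · exact le_top
    rw [h1, h2, hy, EReal.coe_neg]
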